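/- Let $G$ be a connected, simply connected, solvable real Lie group with Lie algebra $\mathfrak g$, and let $\mathfrak n$ be the nilradical of $\mathfrak g$. Let $V\subset\mathfrak g$ be a vector space complement of $\mathfrak n$ such that $(\mathrm{ad}_A)_s(B)=0$ for all $A,B\in V$, where $(\cdot)_s$ is the semisimple part in the Jordan decomposition. Put $\mathrm{ad}_s(A+X)=(\mathrm{ad}_A)_s$ for $A\in V$, $X\in\mathfrak n$, and let $\mathrm{Ad}_s:G\to \mathrm{Aut}(\mathfrak g)$ be the homomorphism of Lie groups with differential $\mathrm{ad}_s$. Let $T$ be the Zariski closure of $\mathrm{Ad}_s(G)$ in $GL(\mathfrak g)$ (real points); it is contained in $\mathrm{Aut}(\mathfrak g)$. The Zariski closure $\mathcal A(\mathrm{Ad}\,G)$ of $\mathrm{Ad}(G)$ is the semidirect product $T\ltimes U$, where $U$ is its unipotent radical; let $\pi:G\to T$ be $\mathrm{Ad}$ followed by the projection $T\ltimes U\to T$. As $G$ is connected, $\pi$ takes values in the identity component $T^\circ$ (for the usual topology). Let $S\subset T$ be an algebraic subtorus, let $p:T^\circ\to S^\circ$ be a projection, i.e. a continuous homomorphism with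 $p|_{S^\circ}=\mathrm{id}$, and put $\pi_S=p\circ\pi$. Identify automorphisms of $\mathfrak g$ with automorphisms of $G$, and let the $S$-modification $G^S$ be the manifold $G$ endowed with the product $$a\bullet_S b=a\cdot\pi_S(a)^{-1}(b).$$ Let $J$ be a left-invariant complex structure on $G$ such that $J\circ \mathrm{Ad}_s(g)=\mathrm{Ad}_s(g)\circ J$ on $\mathfrak g=T_eG$ for every $g\in G$. Then $G^S=(G,\bullet_S)$ is a Lie group and $J$ is also a left-invariant complex structure on $G^S$. Moreover, let $\Gamma$ be a lattice (discrete cocompact subgroup) of $G$ such that $\pi_S|_\Gamma$ is trivial. Then $\Gamma$ is also a lattice of $G^S$, $J$ induces complex structures on the compact quotient manifolds of $G$ and of $G^S$ by the left translations by $\Gamma$, and these two compact complex manifolds (denoted $(G/\Gamma,J)$ and $(G^S/\Gamma,J)$) are biholomorphic. -/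

import Mathlib

open scoped Manifold ContDiff TensorProduct

namespace SMod

noncomputable section

/-! ### Linear algebra: semisimple parts and algebraic subgroups of `GL(W)` -/

section Linear

variable {W : Type*} [AddCommGroup W] [Module ℝ W]

/-- The semisimple part of an endomorphism `f` of a finite-dimensional real vector space
(Jordan–Chevalley): the unique semisimple `s` such that `f = m + s` with `m` nilpotent and
commuting with `s`. -/
def semisimplePart [FiniteDimensional ℝ W] (f : Module.End ℝ W) : Module.End ℝ W :=
  (Module.End.exists_isNilpotent_isSemisimple (f := f)).choose_spec.2.choose

/-- `GL(W)`. -/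
abbrev GLin (W : Type*) [AddCommGroup W] [Module ℝ W] : Type _ := LinearMap.GeneralLinearGroup ℝ W

/-- The usual topology of `GL(W)`, read off from matrices in a basis. -/
instance glTopology [FiniteDimensional ℝ W] : TopologicalSpace (GLin W) :=
  TopologicalSpace.induced
    (Units.mapEquiv
      (LinearMap.toMatrixAlgEquiv (Module.finBasis ℝ W)).toRingEquiv.toMulEquiv) inferInstance

instance glTopologicalGroup [FiniteDimensional ℝ W] : IsTopologicalGroup (GLin W) :=
  topologicalGroup_induced
    (Units.mapEquiv (LinearMap.toMatrixAlgEquiv (Module.finBasis ℝ W)).toRingEquiv.toMulEquiv)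

variable (W) in
/-- The real regular functions on `GL(W)`: polynomials in the matrix entries of `h` and `h⁻¹`. -/
def regularFunctions : Subalgebra ℝ (GLin W → ℝ) :=
  Algebra.adjoin ℝ {f | ∃ φ : Module.Dual ℝ (Module.End ℝ W),
    f = (fun h : GLin W => φ (h : Module.End ℝ W)) ∨
    f = (fun h : GLin W => φ ((h⁻¹ : GLin W) : Module.End ℝ W))}

lemma regular_mul_left (k : GLin W) {f : GLin W → ℝ} (hf : f ∈ regularFunctions W) :
    (fun h => f (k * h)) ∈ regularFunctions W := by
  induction hf using Algebra.adjoin_induction with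
  | mem f hf =>
    obtain ⟨φ, rfl | rfl⟩ := hf
    · exact Algebra.subset_adjoin ⟨φ ∘ₗ LinearMap.mulLeft ℝ (k : Module.End ℝ W), Or.inl rfl⟩
    · refine Algebra.subset_adjoin
        ⟨φ ∘ₗ LinearMap.mulRight ℝ ((k⁻¹ : GLin W) : Module.End ℝ W), Or.inr ?_⟩
      funext h
      simp [mul_inv_rev]
  | algebraMap r => exact (regularFunctions W).algebraMap_mem r
  | add f g _ _ hf hg => exact (regularFunctions W).add_mem hf hg
  | mul f g _ _ hf hg => exact (regularFunctions W).mul_mem hf hg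

lemma regular_mul_right (k : GLin W) {f : GLin W → ℝ} (hf : f ∈ regularFunctions W) :
    (fun h => f (h * k)) ∈ regularFunctions W := by
  induction hf using Algebra.adjoin_induction with
  | mem f hf =>
    obtain ⟨φ, rfl | rfl⟩ := hf
    · exact Algebra.subset_adjoin ⟨φ ∘ₗ LinearMap.mulRight ℝ (k : Module.End ℝ W), Or.inl rfl⟩
    · refine Algebra.subset_adjoin
        ⟨φ ∘ₗ LinearMap.mulLeft ℝ ((k⁻¹ : GLin W) : Module.End ℝ W), Or.inr ?_⟩
      funext h
      simp [mul_inv_rev]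
  | algebraMap r => exact (regularFunctions W).algebraMap_mem r
  | add f g _ _ hf hg => exact (regularFunctions W).add_mem hf hg
  | mul f g _ _ hf hg => exact (regularFunctions W).mul_mem hf hg

lemma regular_inv {f : GLin W → ℝ} (hf : f ∈ regularFunctions W) :
    (fun h => f h⁻¹) ∈ regularFunctions W := by
  induction hf using Algebra.adjoin_induction with
  | mem f hf =>
    obtain ⟨φ, rfl | rfl⟩ := hf
    · exact Algebra.subset_adjoin ⟨φ, Or.inr rfl⟩
    · refine Algebra.subset_adjoin ⟨φ, Or.inl ?_⟩
      funext h
      simp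
  | algebraMap r => exact (regularFunctions W).algebraMap_mem r
  | add f g _ _ hf hg => exact (regularFunctions W).add_mem hf hg
  | mul f g _ _ hf hg => exact (regularFunctions W).mul_mem hf hg

/-- The (real) Zariski closure in `GL(W)` of a subgroup of `GL(W)`. -/
def zariskiClosure (A : Subgroup (GLin W)) : Subgroup (GLin W) where
  carrier := {h | ∀ f ∈ regularFunctions W, (∀ a ∈ A, f a = 0) → f h = 0}
  one_mem' f _ h0 := h0 1 A.one_mem
  mul_mem' := by
    intro x y hx hy f hf h0
    have h1 : ∀ a ∈ A, f (a * y) = 0 := fun a ha =>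
      hy (fun h => f (a * h)) (regular_mul_left a hf) fun b hb => h0 _ (A.mul_mem ha hb)
    exact hx (fun h => f (h * y)) (regular_mul_right y hf) h1
  inv_mem' := by
    intro x hx f hf h0
    exact hx (fun h => f h⁻¹) (regular_inv hf) fun a ha => h0 _ (A.inv_mem ha)

/-- `S` is (the group of real points of) an algebraic torus in `GL(W)`: Zariski closed,
Zariski connected (for algebraic groups, the same as irreducible), and simultaneously
diagonalizable over `ℂ`. -/
structure IsAlgebraicTorus (S : Subgroup (GLin W)) : Prop where
  closed : zariskiClosure S = S
  irreducible : ∀ f ∈ regularFunctions W, ∀ g ∈ regularFunctions W,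
    (∀ s ∈ S, f s * g s = 0) → (∀ s ∈ S, f s = 0) ∨ (∀ s ∈ S, g s = 0)
  diagonalizable : ∃ b : Module.Basis (Fin (Module.finrank ℝ W)) ℂ (ℂ ⊗[ℝ] W),
    ∀ s ∈ S, ∀ i, ∃ c : ℂ, (s : Module.End ℝ W).baseChange ℂ (b i) = c • b i

/-- `U` is the unipotent radical of the algebraic group `A`, i.e. its largest normal subgroup
consisting of unipotent elements (in characteristic zero it is automatically closed and
connected). -/
def IsUnipotentRadical (A U : Subgroup (GLin W)) : Prop :=
  IsGreatest {N : Subgroup (GLin W) | N ≤ A ∧ (∀ a ∈ A, ∀ u ∈ N, a * u * a⁻¹ ∈ N) ∧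
    ∀ u ∈ N, IsNilpotent ((u : Module.End ℝ W) - 1)} U

/-- The identity component, for the usual topology, of a subgroup of `GL(W)`. -/
def identityComponent [FiniteDimensional ℝ W] (A : Subgroup (GLin W)) : Subgroup (GLin W) :=
  (Subgroup.connectedComponentOfOne A).map A.subtype

/-- A projection of (the identity component of) `T` onto (that of) its subgroup `S`: a
continuous homomorphism which is the identity on `S`. If `T = S × S'` this is the projection
with kernel `S'`. -/
structure IsProjection [FiniteDimensional ℝ W] (T S : Subgroup (GLin W))
    (p : identityComponent T →* identityComponent S) : Prop where
  continuous : Continuous p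
  eq_self : ∀ t : identityComponent T, (t : GLin W) ∈ identityComponent S → (p t : GLin W) = t

/-- The nilradical of a real Lie algebra: the sum of its nilpotent ideals, which is
the largest nilpotent ideal in finite dimension. -/
def nilradical (L : Type*) [LieRing L] [LieAlgebra ℝ L] : LieIdeal ℝ L :=
  sSup {I : LieIdeal ℝ L | LieRing.IsNilpotent I}

end Linear

/-! ### Almost complex and complex structures -/

section Complex

variable {n : ℕ} {M M' : Type*} [TopologicalSpace M] [ChartedSpace (EuclideanSpace ℝ (Fin n)) M]
  [TopologicalSpace M'] [ChartedSpace (EuclideanSpace ℝ (Fin n)) M']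

variable (n M) in
/-- Fields of endomorphisms of the tangent spaces of `M`. -/
abbrev EndField : Type _ := (x : M) → TangentSpace (𝓡 n) x →L[ℝ] TangentSpace (𝓡 n) x

/-- A field of vectors is smooth at `x`. -/
def SmoothFieldAt [IsManifold (𝓡 n) ∞ M] (X : (y : M) → TangentSpace (𝓡 n) y) (x : M) : Prop :=
  ContMDiffAt (𝓡 n) (𝓡 n).tangent ∞ (fun y => (⟨y, X y⟩ : TangentBundle (𝓡 n) M)) x

/-- `J` is a complex structure on the smooth manifold `M`: a smooth field of endomorphisms with
`J² = -1` whose Nijenhuis tensor vanishes. -/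
structure IsComplexStructure [IsManifold (𝓡 n) ∞ M] (J : EndField n M) : Prop where
  smooth : ContMDiff (𝓡 n).tangent (𝓡 n).tangent ∞
    (fun v : TangentBundle (𝓡 n) M => (⟨v.proj, J v.proj v.snd⟩ : TangentBundle (𝓡 n) M))
  sq : ∀ (x : M) (v : TangentSpace (𝓡 n) x), J x (J x v) = -v
  integrable : ∀ (x : M) (X Y : (y : M) → TangentSpace (𝓡 n) y),
    SmoothFieldAt X x → SmoothFieldAt Y x →
    VectorField.mlieBracket (𝓡 n) (fun y => J y (X y)) (fun y => J y (Y y)) x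
      - J x (VectorField.mlieBracket (𝓡 n) (fun y => J y (X y)) Y x)
      - J x (VectorField.mlieBracket (𝓡 n) X (fun y => J y (Y y)) x)
      - VectorField.mlieBracket (𝓡 n) X Y x = 0

/-- `(M, J)` and `(M', J')` are biholomorphic: there is a diffeomorphism whose differential
intertwines `J` and `J'`. -/
def Biholomorphic (J : EndField n M) (J' : EndField n M') : Prop :=
  ∃ F : M ≃ₘ⟮𝓡 n, 𝓡 n⟯ M', ∀ (x : M) (v : TangentSpace (𝓡 n) x),
    mfderiv (𝓡 n) (𝓡 n) F x (J x v) = J' (F x) (mfderiv (𝓡 n) (𝓡 n) F x v)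

end Complex

/-! ### Lie groups -/

section LieGroups

variable {n : ℕ} {G : Type*} [TopologicalSpace G] [ChartedSpace (EuclideanSpace ℝ (Fin n)) G]
  [Group G]

variable (n G) in
/-- The Lie algebra of `G`. -/
abbrev Lie : Type := GroupLieAlgebra (𝓡 n) G

instance finiteDimensional_lie : FiniteDimensional ℝ (Lie n G) :=
  inferInstanceAs (FiniteDimensional ℝ (EuclideanSpace ℝ (Fin n)))

/-- The differential at `1` of an endomorphism `f` of `G`, an endomorphism of `T₁G` as
`f 1 = 1`. -/
def lieMap (f : G →* G) : Lie n G →ₗ[ℝ] Lie n G :=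
  (show EuclideanSpace ℝ (Fin n) →L[ℝ] EuclideanSpace ℝ (Fin n) from
    mfderiv (𝓡 n) (𝓡 n) f (1 : G)).toLinearMap

lemma lieMap_id : lieMap (n := n) (MonoidHom.id G) = 1 := by
  have := mfderiv_id (I := 𝓡 n) (x := (1 : G))
  unfold lieMap
  ext v : 1
  exact congrArg (fun L : EuclideanSpace ℝ (Fin n) →L[ℝ] EuclideanSpace ℝ (Fin n) => L v) this

lemma lieMap_comp (f g : G →* G) (hf : MDifferentiable (𝓡 n) (𝓡 n) f)
    (hg : MDifferentiable (𝓡 n) (𝓡 n) g) :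
    lieMap (n := n) (f.comp g) = lieMap f * lieMap g := by
  have h := mfderiv_comp (1 : G) (hf (g 1)) (hg 1)
  rw [map_one g] at h
  ext v : 1
  exact congrArg (fun L : EuclideanSpace ℝ (Fin n) →L[ℝ] EuclideanSpace ℝ (Fin n) => L v) h

lemma mdifferentiable_conj [LieGroup (𝓡 n) ∞ G] (g : G) :
    MDifferentiable (𝓡 n) (𝓡 n) ((MulAut.conj g).toMonoidHom : G →* G) := by
  have h : ContMDiff (𝓡 n) (𝓡 n) ∞ (fun x : G => g * x * g⁻¹) :=
    (contMDiff_const.mul contMDiff_id).mul contMDiff_const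
  exact h.mdifferentiable (by simp)

variable (n G) in
/-- The adjoint representation `Ad : G → GL(𝔤)`, where `Ad_g` is the differential at `1` of
`x ↦ g x g⁻¹`. -/
def Ad [LieGroup (𝓡 n) ∞ G] : G →* GLin (Lie n G) :=
  MonoidHom.toHomUnits
    { toFun := fun g => lieMap (MulAut.conj g).toMonoidHom
      map_one' := by
        rw [map_one]
        exact lieMap_id
      map_mul' := fun g h => by
        rw [map_mul]
        exact lieMap_comp _ _ (mdifferentiable_conj g) (mdifferentiable_conj h) }

instance lieGroup_minSmoothness [LieGroup (𝓡 n) ∞ G] :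
    LieGroup (𝓡 n) (minSmoothness ℝ 3) G :=
  by
  rw [minSmoothness_of_isRCLikeNormedField]
  infer_instance

section Modification

variable [LieGroup (𝓡 n) ∞ G]

/-- `V` is a vector space complement of the nilradical in `𝔤` with `(ad A)_s B = 0` for all
`A, B ∈ V`. -/
structure IsAdmissibleComplement (V : Submodule ℝ (Lie n G)) : Prop where
  isCompl : IsCompl V (nilradical (Lie n G)).toSubmodule
  semisimplePart_ad : ∀ A ∈ V, ∀ B ∈ V, semisimplePart (LieAlgebra.ad ℝ (Lie n G) A) B = 0

variable {V : Submodule ℝ (Lie n G)}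

/-- `ad_s (A + X) = (ad A)_s` for `A ∈ V` and `X` in the nilradical. -/
def ads (hV : IsAdmissibleComplement V) (x : Lie n G) : Module.End ℝ (Lie n G) :=
  semisimplePart (LieAlgebra.ad ℝ (Lie n G) (V.projectionOnto _ hV.isCompl x : Lie n G))

/-- `ρ` is a smooth representation of `G` on `𝔤` with differential `ad_s`. -/
def IntegratesAds (hV : IsAdmissibleComplement V) (ρ : G →* GLin (Lie n G)) : Prop :=
  ∀ v : Lie n G,
    ContMDiff (𝓡 n) (𝓡 n) ∞
      (fun a : G => (show EuclideanSpace ℝ (Fin n) from (ρ a : Module.End ℝ (Lie n G)) v)) ∧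
    ∀ x : Lie n G, mfderiv (𝓡 n) (𝓡 n)
      (fun a : G => (show EuclideanSpace ℝ (Fin n) from (ρ a : Module.End ℝ (Lie n G)) v)) 1 x
        = ads hV x v

open Classical in
/-- `Ad_s : G → GL(𝔤)`, the representation with differential `ad_s`. It exists and is unique
since `G` is simply connected; the default value is never used. -/
def Ads (hV : IsAdmissibleComplement V) : G →* GLin (Lie n G) :=
  if h : ∃ ρ, IntegratesAds hV ρ then h.choose else 1

/-- `T`, the Zariski closure of `Ad_s(G)`. -/
def maxTorus (hV : IsAdmissibleComplement V) : Subgroup (GLin (Lie n G)) :=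
  zariskiClosure (Ads hV).range

/-- `π` is `Ad` followed by the projection to `T` in `𝒜(Ad G) = T ⋉ U`, where
`𝒜(Ad G)` is the Zariski closure of `Ad G` and `U` is its unipotent radical. -/
def IsTorusPart (hV : IsAdmissibleComplement V) (π : G →* identityComponent (maxTorus hV)) :
    Prop :=
  ∃ U, IsUnipotentRadical (zariskiClosure (Ad n G).range) U ∧
    ∀ g, (π g : GLin (Lie n G))⁻¹ * Ad n G g ∈ U

open Classical in
/-- The homomorphism `π : G → T`; its values lie in the identity component as `G` is connected.
The decomposition `𝒜(Ad G) = T ⋉ U` shows that it exists and is unique; the default value is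
never used. -/
def torusPart (hV : IsAdmissibleComplement V) : G →* identityComponent (maxTorus hV) :=
  if h : ∃ π, IsTorusPart hV π then h.choose else 1

/-- `π_S : G → T → S`, for a projection `p : T → S`. -/
def piS (hV : IsAdmissibleComplement V) {S : Subgroup (GLin (Lie n G))}
    (p : identityComponent (maxTorus hV) →* identityComponent S) : G →* GLin (Lie n G) :=
  (identityComponent S).subtype.comp (p.comp (torusPart hV))

/-- `Θ` is a smooth action of `G` on itself by automorphisms of `G` such that the differential
of `Θ a` at `1` is `ρ a`. -/
def IntegratesAction (ρ : G →* GLin (Lie n G)) (Θ : G →* MulAut G) : Prop :=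
  ContMDiff ((𝓡 n).prod (𝓡 n)) (𝓡 n) ∞ (fun q : G × G => Θ q.1 q.2) ∧
    ∀ a, lieMap (n := n) (Θ a).toMonoidHom = (ρ a : Module.End ℝ (Lie n G))

open Classical in
/-- The action of `G` on itself through `ρ : G → Aut(𝔤) = Aut(G)`. For simply connected `G`
and a smooth `ρ` with values in `Aut(𝔤)` it exists and is unique; the default value is never
used. -/
def action (ρ : G →* GLin (Lie n G)) : G →* MulAut G :=
  if h : ∃ Θ, IntegratesAction ρ Θ then h.choose else 1

variable (G) in
/-- The manifold underlying the modification `G^S`: it is `G` itself, without its product. -/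
def Modification : Type _ := G

instance : TopologicalSpace (Modification G) := inferInstanceAs (TopologicalSpace G)

instance : ChartedSpace (EuclideanSpace ℝ (Fin n)) (Modification G) :=
  inferInstanceAs (ChartedSpace (EuclideanSpace ℝ (Fin n)) G)

instance [h : T2Space G] : T2Space (Modification G) := h

/-- The identity map from `G` to the modification. -/
def toModification (a : G) : Modification G := a

/-- An endomorphism field on `G`, seen on the modification (the same manifold). -/
def EndField.onModification (J : EndField n G) : EndField n (Modification G) := J

/-- The product `a • b = a · π_S(a)⁻¹(b)`. -/
def modMul (hV : IsAdmissibleComplement V) {S : Subgroup (GLin (Lie n G))}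
    (p : identityComponent (maxTorus hV) →* identityComponent S) (a b : G) : G :=
  a * (action (piS hV p) a)⁻¹ b

end Modification

/-- A left-invariant complex structure on the Lie group `G`. -/
structure IsLeftInvariantComplexStructure [LieGroup (𝓡 n) ∞ G] (J : EndField n G) : Prop
    extends IsComplexStructure J where
  invariant : ∀ (g h : G) (v : TangentSpace (𝓡 n) h),
    mfderiv (𝓡 n) (𝓡 n) (fun x => g * x) h (J h v)
      = J (g * h) (mfderiv (𝓡 n) (𝓡 n) (fun x => g * x) h v)

/-- The quotient of `G` by the action of the subgroup `Γ` by left translations. -/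
def LeftQuotient (Γ : Subgroup G) : Type _ := MulAction.orbitRel.Quotient Γ G

instance (Γ : Subgroup G) : TopologicalSpace (LeftQuotient Γ) :=
  inferInstanceAs (TopologicalSpace (MulAction.orbitRel.Quotient Γ G))

/-- The projection `G → Γ\G`. -/
def LeftQuotient.mk (Γ : Subgroup G) (g : G) : LeftQuotient Γ :=
  Quotient.mk (MulAction.orbitRel Γ G) g

/-- A lattice: a discrete cocompact subgroup. -/
class IsLattice (Γ : Subgroup G) : Prop where
  discrete : DiscreteTopology Γ
  cocompact : CompactSpace (LeftQuotient Γ)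

/-- The manifold `Γ\G`, with local sections of the covering `G → Γ\G` followed by charts of `G`
as charts. -/
instance [LieGroup (𝓡 n) ∞ G] [T2Space G] (Γ : Subgroup G) [IsLattice Γ] :
    ChartedSpace (EuclideanSpace ℝ (Fin n)) (LeftQuotient Γ) :=
  haveI : DiscreteTopology Γ := IsLattice.discrete
  haveI : IsTopologicalGroup G := topologicalGroup_of_lieGroup (𝓡 n) ∞
  haveI : LocallyCompactSpace G := Manifold.locallyCompact_of_finiteDimensional (𝓡 n)
  haveI : ProperlyDiscontinuousSMul Γ G :=
    Subgroup.properlyDiscontinuousSMul_of_tendsto_cofinite Γ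
      (by
        let _ : UniformSpace G := IsTopologicalGroup.rightUniformSpace G
        have : IsRightUniformGroup G := ⟨rfl⟩
        exact Γ.tendsto_coe_cofinite_of_discrete
          (isDiscrete_iff_discreteTopology.mpr IsLattice.discrete))
  MulAction.instChartedSpaceQuotient (M := G) (G := Γ)

/-- `J'` is the complex structure induced on the smooth quotient manifold `Γ\G` by the complex
structure `J` of `G`: the projection is a local diffeomorphism, and it maps `J` to `J'`. -/
structure IsInducedComplexStructure [LieGroup (𝓡 n) ∞ G] [T2Space G] (Γ : Subgroup G)
    [IsLattice Γ] (J : EndField n G) (J' : EndField n (LeftQuotient Γ)) : Prop where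
  isManifold : IsManifold (𝓡 n) ∞ (LeftQuotient Γ)
  isLocalDiffeomorph : IsLocalDiffeomorph (𝓡 n) (𝓡 n) ∞ (LeftQuotient.mk Γ)
  isComplexStructure : IsComplexStructure J'
  induced : ∀ (g : G) (v : TangentSpace (𝓡 n) g),
    mfderiv (𝓡 n) (𝓡 n) (LeftQuotient.mk Γ) g (J g v)
      = J' (LeftQuotient.mk Γ g) (mfderiv (𝓡 n) (𝓡 n) (LeftQuotient.mk Γ) g v)

end LieGroups

end

end SMod

namespace SMod

/-! ### Jordan decomposition of derivations -/

section Jordan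

variable {W : Type*} [AddCommGroup W] [Module ℝ W] [FiniteDimensional ℝ W]

/-! Let Θ be the action of G on itself that integrates π_S. The modification is G twisted by Θ, and
the theorem rests on four properties, packaged in `IsTwisting`: Θ is smooth, its values commute,
Θ(Θ_a b) = Θ(b), and every differential of Θ_a at 1 commutes with J. Given these, Θ(a • b) =
Θ(a)Θ(b), which makes • associative. Left translation by a for • is L_a ∘ Θ_a⁻¹, a composition of
maps that preserve J. If Θ is trivial on Γ, then γ • b = γ b, so Γ has the same orbits for both
products and the identity of G descends to a biholomorphism of the quotients
(`biholomorphic_of_comp`).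

The algebraic properties come from T. The endomorphisms (ad A)_s with A ∈ V are derivations killing
V, hence commute (`commute_semisimplePart_ad`), and they generate a commutative algebra of
semisimple endomorphisms. By a double centralizer argument (`mem_adjoin_of_centralizer`) this
algebra contains Ad_s(G), and then also T, since a linear condition passes to the Zariski closure.
For the same reason T fixes V pointwise and commutes with J at 1.

The invariance Θ(Θ_a b) = Θ(b) (`IntegratesAction.piS_apply`) is checked on differentials. Let D be
the differential of π_S at 1; one needs D ∘ π_S(a) = D. Now π_S(a) fixes V and preserves 𝔫, so it
suffices that D kills 𝔫. Along an integral curve of X ∈ 𝔫, Ad is exp(t ad X), which lies in the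
unipotent radical (`IsLocalOneParam.Ad_mem_unipotentRadical`). The torus part of the curve is
therefore unipotent as well as semisimple, hence trivial.

`Ads`, `torusPart` and `action` are choices with the trivial homomorphism as default. Every lemma
that unfolds one of them treats both cases, so no existence theorem is invoked. -/

lemma semisimplePart_spec (f : Module.End ℝ W) :
    ∃ m ∈ Algebra.adjoin ℝ {f}, IsNilpotent m ∧ (semisimplePart f).IsSemisimple ∧
      semisimplePart f ∈ Algebra.adjoin ℝ {f} ∧ f = m + semisimplePart f := by
  have h := (Module.End.exists_isNilpotent_isSemisimple (f := f)).choose_spec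
  obtain ⟨h1, h2, h3, h4⟩ := h.2.choose_spec
  exact ⟨_, h.1, h2, h3, h1, h4⟩

/-- An algebra homomorphism maps semisimple endomorphisms to semisimple endomorphisms. -/
lemma isSemisimple_map {B : Type*} [AddCommGroup B] [Module ℝ B] {f : Module.End ℝ W}
    (hf : f.IsSemisimple) (φ : Module.End ℝ W →ₐ[ℝ] Module.End ℝ B) : (φ f).IsSemisimple := by
  refine Module.End.isSemisimple_of_squarefree_aeval_eq_zero hf.minpoly_squarefree ?_
  rw [Polynomial.aeval_algHom_apply, minpoly.aeval, map_zero]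

lemma isSemisimple_map_op {B : Type*} [AddCommGroup B] [Module ℝ B] {f : Module.End ℝ W}
    (hf : f.IsSemisimple) (φ : Module.End ℝ W →ₐ[ℝ] (Module.End ℝ B)ᵐᵒᵖ) :
    (φ f).unop.IsSemisimple := by
  refine Module.End.isSemisimple_of_squarefree_aeval_eq_zero hf.minpoly_squarefree ?_
  have h : Polynomial.aeval (φ f) (minpoly ℝ f) = 0 := by
    rw [Polynomial.aeval_algHom_apply, minpoly.aeval, map_zero]
  -- Passing to the opposite algebra reverses products, but a polynomial in one element only
  -- involves its powers.
  have h2 := congrArg MulOpposite.unop h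
  rw [Polynomial.aeval_eq_sum_range] at h2 ⊢
  simpa using h2

/-- `f ↦ (g ↦ g ∘ f)`, with values in the opposite algebra. -/
noncomputable def precompOp (W B : Type*) [AddCommGroup W] [Module ℝ W] [AddCommGroup B]
    [Module ℝ B] : Module.End ℝ W →ₐ[ℝ] (Module.End ℝ (W →ₗ[ℝ] B))ᵐᵒᵖ where
  toFun f := MulOpposite.op (LinearMap.lcomp ℝ B f)
  map_one' := by apply MulOpposite.unop_injective; ext; simp
  map_mul' f g := by apply MulOpposite.unop_injective; ext; simp
  map_zero' := by apply MulOpposite.unop_injective; ext; simp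
  map_add' f g := by apply MulOpposite.unop_injective; ext; simp
  commutes' r := by apply MulOpposite.unop_injective; ext; simp [Algebra.algebraMap_eq_smul_one]

/-- `f ↦ (g ↦ f ∘ g)`. -/
noncomputable def postcomp (W B : Type*) [AddCommGroup W] [Module ℝ W] [AddCommGroup B]
    [Module ℝ B] : Module.End ℝ B →ₐ[ℝ] Module.End ℝ (W →ₗ[ℝ] B) where
  toFun f := LinearMap.compRight ℝ f
  map_one' := by ext; simp
  map_mul' f g := by ext; simp
  map_zero' := by ext; simp
  map_add' f g := by ext; simp
  commutes' r := by ext; simp [Algebra.algebraMap_eq_smul_one]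

lemma isNilpotent_sub_sub {A : Type*} [Ring A] {p q r : A} (hp : IsNilpotent p)
    (hq : IsNilpotent q) (hr : IsNilpotent r) (h1 : Commute p q) (h2 : Commute p r)
    (h3 : Commute q r) : IsNilpotent (p - q - r) :=
  (h2.sub_left h3).isNilpotent_sub (h1.isNilpotent_sub hp hq) hr

lemma commute_sub_sub {A : Type*} [Ring A] {p q r p' q' r' : A} (h1 : Commute p p')
    (h2 : Commute p q') (h3 : Commute p r') (h4 : Commute q p') (h5 : Commute q q')
    (h6 : Commute q r') (h7 : Commute r p') (h8 : Commute r q') (h9 : Commute r r') :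
    Commute (p - q - r) (p' - q' - r') :=
  (((h1.sub_right h2).sub_right h3).sub_left ((h4.sub_right h5).sub_right h6)).sub_left
    ((h7.sub_right h8).sub_right h9)

/-- The kernel of m + s is stable under both maps, and there s = -m. So the restriction of s is
nilpotent and semisimple, hence zero. -/
lemma eq_zero_of_nilpotent_add_semisimple {B : Type*} [AddCommGroup B] [Module ℝ B]
    [FiniteDimensional ℝ B] {m s : Module.End ℝ B} (hm : IsNilpotent m) (hs : s.IsSemisimple)
    (hc : Commute m s) {b : B} (hb : (m + s) b = 0) : s b = 0 := by
  have h1 : LinearMap.ker (m + s) ∈ s.invtSubmodule := by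
    intro x hx
    have : (m + s) (s x) = s ((m + s) x) := by
      have := LinearMap.congr_fun hc.eq x
      simp only [Module.End.mul_apply] at this
      simp [this]
    simp only [LinearMap.mem_ker, Submodule.mem_comap] at hx ⊢
    rw [this, hx, map_zero]
  have h2 : LinearMap.ker (m + s) ∈ m.invtSubmodule := by
    intro x hx
    have : (m + s) (m x) = m ((m + s) x) := by
      have := LinearMap.congr_fun hc.eq x
      simp only [Module.End.mul_apply] at this
      simp [this]
    simp only [LinearMap.mem_ker, Submodule.mem_comap] at hx ⊢
    rw [this, hx, map_zero]
  have h3 := hs.restrict h1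
  have h4 : IsNilpotent (LinearMap.restrict s (p := LinearMap.ker (m + s))
      (q := LinearMap.ker (m + s)) h1) := by
    have h5 : LinearMap.restrict s (p := LinearMap.ker (m + s)) (q := LinearMap.ker (m + s)) h1 =
        -(LinearMap.restrict m (p := LinearMap.ker (m + s)) (q := LinearMap.ker (m + s)) h2) := by
      ext x
      have := x.2
      rw [LinearMap.mem_ker, LinearMap.add_apply] at this
      exact eq_neg_of_add_eq_zero_right this
    rw [h5]
    exact (Module.End.isNilpotent.restrict h2 hm).neg
  have h6 := Module.End.eq_zero_of_isNilpotent_isSemisimple h4 h3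
  exact congrArg Subtype.val (LinearMap.congr_fun h6 ⟨b, hb⟩)

end Jordan

section Derivation

variable {L : Type*} [LieRing L] [LieAlgebra ℝ L] [FiniteDimensional ℝ L]

/-- The semisimple part of a derivation is a derivation. -/
lemma semisimplePart_ad_lie (x y z : L) :
    semisimplePart (LieAlgebra.ad ℝ L x) ⁅y, z⁆ =
      ⁅semisimplePart (LieAlgebra.ad ℝ L x) y, z⁆ +
        ⁅y, semisimplePart (LieAlgebra.ad ℝ L x) z⁆ := by
  set D := LieAlgebra.ad ℝ L x with hD
  obtain ⟨m, hmD, hm, hs, hsD, hDm⟩ := semisimplePart_spec D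
  set s := semisimplePart D
  have hms : Commute m s := by
    have h1 := Algebra.commute_of_mem_adjoin_singleton_of_commute hsD (Commute.refl D).symm
    exact Algebra.commute_of_mem_adjoin_singleton_of_commute hmD h1.symm |>.symm
  -- An endomorphism f acts on bilinear maps b by P f - Q f - Q' f, that is, f(b(y,z)) - b(fy,z) -
  -- b(y,fz); derivations are the f that kill the bracket. Precomposition reverses products, hence
  -- the opposite algebras.
  let P : Module.End ℝ L →ₐ[ℝ] Module.End ℝ (L →ₗ[ℝ] L →ₗ[ℝ] L) :=
    (postcomp L (L →ₗ[ℝ] L)).comp (postcomp L L)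
  let Q : Module.End ℝ L →ₐ[ℝ] (Module.End ℝ (L →ₗ[ℝ] L →ₗ[ℝ] L))ᵐᵒᵖ := precompOp L (L →ₗ[ℝ] L)
  let Q' : Module.End ℝ L →ₐ[ℝ] (Module.End ℝ (L →ₗ[ℝ] L →ₗ[ℝ] L))ᵐᵒᵖ :=
    (AlgHom.op (postcomp L (L →ₗ[ℝ] L))).comp (precompOp L L)
  have hP : ∀ f b y z, P f b y z = f (b y z) := fun _ _ _ _ => rfl
  have hQ : ∀ f b y z, (Q f).unop b y z = b (f y) z := fun _ _ _ _ => rfl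
  have hQ' : ∀ f b y z, (Q' f).unop b y z = b y (f z) := fun _ _ _ _ => rfl
  have cPQ : ∀ f g, Commute (P f) (Q g).unop := fun f g => by
    ext b y z; simp [hP, hQ]
  have cPQ' : ∀ f g, Commute (P f) (Q' g).unop := fun f g => by
    ext b y z; simp [hP, hQ']
  have cQQ' : ∀ f g, Commute (Q f).unop (Q' g).unop := fun f g => by
    ext b y z; simp [hQ, hQ']
  have cP : ∀ f g, Commute f g → Commute (P f) (P g) := fun f g h => h.map P
  have cQ : ∀ f g, Commute f g → Commute (Q f).unop (Q g).unop := fun f g h => (h.map Q).unop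
  have cQ' : ∀ f g, Commute f g → Commute (Q' f).unop (Q' g).unop := fun f g h => (h.map Q').unop
  have nQ : ∀ R : Module.End ℝ L →ₐ[ℝ] (Module.End ℝ (L →ₗ[ℝ] L →ₗ[ℝ] L))ᵐᵒᵖ,
      IsNilpotent (R m).unop := fun R => by
    obtain ⟨k, hk⟩ := hm.map R
    exact ⟨k, by rw [← MulOpposite.unop_pow, hk, MulOpposite.unop_zero]⟩
  -- The actions of m and s on bilinear maps are nilpotent, semisimple and commuting. Their sum, the
  -- action of D, kills the bracket by the Jacobi identity, so the action of s does too.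
  have key := eq_zero_of_nilpotent_add_semisimple (m := P m - (Q m).unop - (Q' m).unop)
    (s := P s - (Q s).unop - (Q' s).unop) (b := (LieAlgebra.ad ℝ L : L →ₗ[ℝ] Module.End ℝ L))
    ?_ ?_ ?_ ?_
  · have := LinearMap.congr_fun₂ key y z
    simp only [LinearMap.sub_apply, hP, hQ, hQ', LinearMap.zero_apply, LieHom.coe_toLinearMap,
      LieAlgebra.ad_apply] at this
    rw [sub_sub, sub_eq_zero] at this
    exact this
  · exact isNilpotent_sub_sub (A := Module.End ℝ (L →ₗ[ℝ] L →ₗ[ℝ] L)) (hm.map P)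
      (nQ Q) (nQ Q') (cPQ m m) (cPQ' m m) (cQQ' m m)
  · exact ((isSemisimple_map hs P).sub_of_commute (cPQ s s)
      (isSemisimple_map_op hs Q)).sub_of_commute
      (Commute.sub_left (R := Module.End ℝ (L →ₗ[ℝ] L →ₗ[ℝ] L)) (cPQ' s s) (cQQ' s s))
      (isSemisimple_map_op hs Q')
  · exact commute_sub_sub (A := Module.End ℝ (L →ₗ[ℝ] L →ₗ[ℝ] L)) (cP _ _ hms) (cPQ _ _)
      (cPQ' _ _) (cPQ _ _).symm (cQ _ _ hms) (cQQ' _ _) (cPQ' _ _).symm (cQQ' _ _).symm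
      (cQ' _ _ hms)
  · ext y z
    have h : ∀ w, m w + s w = ⁅x, w⁆ := fun w => by
      rw [← LinearMap.add_apply, ← hDm, hD, LieAlgebra.ad_apply]
    simp only [LinearMap.add_apply, LinearMap.sub_apply, hP, hQ, hQ', LieHom.coe_toLinearMap,
      LieAlgebra.ad_apply, LinearMap.zero_apply]
    have h2 : ⁅x, ⁅y, z⁆⁆ = ⁅⁅x, y⁆, z⁆ + ⁅y, ⁅x, z⁆⁆ := leibniz_lie x y z
    rw [← h, ← h y, ← h z, add_lie, lie_add] at h2
    rw [sub_sub, sub_sub, sub_add_sub_comm, h2]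
    abel

/-- If `s = (ad x)_s` kills `y` then it commutes with `(ad y)_s`. -/
lemma commute_semisimplePart_ad {x y : L}
    (h : semisimplePart (LieAlgebra.ad ℝ L x) y = 0) :
    Commute (semisimplePart (LieAlgebra.ad ℝ L x)) (semisimplePart (LieAlgebra.ad ℝ L y)) := by
  -- For a derivation s, the commutator of s and ad y is ad (s y) = 0; and (ad y)_s is a polynomial
  -- in ad y.
  have h1 : Commute (semisimplePart (LieAlgebra.ad ℝ L x)) (LieAlgebra.ad ℝ L y) := by
    ext z
    simp [semisimplePart_ad_lie, h]
  obtain ⟨-, -, -, -, h2, -⟩ := semisimplePart_spec (LieAlgebra.ad ℝ L y)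
  exact Algebra.commute_of_mem_adjoin_singleton_of_commute h2 h1

end Derivation

/-! ### Commuting families of semisimple endomorphisms -/

section Commuting

variable {W : Type*} [AddCommGroup W] [Module ℝ W] [FiniteDimensional ℝ W]

lemma isSemisimple_of_mem_adjoin {s : Set (Module.End ℝ W)} (hs : ∀ f ∈ s, f.IsSemisimple)
    (hc : ∀ f ∈ s, ∀ g ∈ s, Commute f g) {f : Module.End ℝ W} (hf : f ∈ Algebra.adjoin ℝ s) :
    f.IsSemisimple := by
  have hcomm : ∀ f ∈ Algebra.adjoin ℝ s, ∀ g ∈ Algebra.adjoin ℝ s, Commute f g := fun f hf g hg =>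
    Algebra.commute_of_mem_adjoin_of_forall_mem_commute hg fun b hb =>
      (Algebra.commute_of_mem_adjoin_of_forall_mem_commute hf fun c hc' => hc b hb c hc').symm
  induction hf using Algebra.adjoin_induction with
  | mem f hf => exact hs f hf
  | algebraMap r =>
    rw [Algebra.algebraMap_eq_smul_one]
    exact Module.End.IsSemisimple_smul r Module.End.isSemisimple_id
  | add f g hf hg h1 h2 => exact h1.add_of_commute (hcomm f hf g hg) h2
  | mul f g hf hg h1 h2 => exact h1.mul_of_commute (hcomm f hf g hg) h2

/-- The double centralizer of a commuting family of semisimple endomorphisms is the algebra that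
it generates. -/
lemma mem_adjoin_of_centralizer {s : Set (Module.End ℝ W)} (hs : ∀ f ∈ s, f.IsSemisimple)
    (hc : ∀ f ∈ s, ∀ g ∈ s, Commute f g) {f : Module.End ℝ W}
    (hf : ∀ c : Module.End ℝ W, (∀ g ∈ s, Commute c g) → Commute c f) :
    f ∈ Algebra.adjoin ℝ s := by
  let R := Algebra.adjoin ℝ s
  have : IsMulCommutative R := Algebra.isMulCommutative_adjoin ℝ fun a ha b hb => hc a ha b hb
  let _ : CommRing R := { (inferInstance : Ring R) with
    mul_comm := fun a b => IsMulCommutative.is_comm.comm a b }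
  -- All elements of R are semisimple, so none is nilpotent except 0. Being Artinian and reduced, R
  -- is a semisimple ring, which makes W a semisimple module.
  have : IsReduced R := ⟨fun x hx => by
    have h1 : IsNilpotent (x : Module.End ℝ W) := hx.map R.val
    exact Subtype.ext (Module.End.eq_zero_of_isNilpotent_isSemisimple h1
      (isSemisimple_of_mem_adjoin hs hc x.2))⟩
  have : Module.Finite ℝ R := inferInstance
  have : IsArtinianRing R := .of_finite ℝ R
  have : IsSemisimpleRing R := IsArtinianRing.isSemisimpleRing_of_isReduced R
  -- An R-linear e commutes with the generators, so the hypothesis makes it commute with f: f is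
  -- linear over `Module.End R W`.
  let F : Module.End (Module.End R W) W :=
    { toFun := f
      map_add' := map_add f
      map_smul' := fun e w => by
        have h2 := hf (e.restrictScalars ℝ) fun g hg => by
          ext w
          exact e.map_smul (⟨g, Algebra.subset_adjoin hg⟩ : R) w
        exact (LinearMap.congr_fun h2.eq w).symm }
  classical
  -- Density at the vectors of a finite basis yields an element of R equal to f everywhere.
  obtain ⟨r, hr⟩ := jacobson_density (R := R) F
    (Finset.univ.image (Module.finBasis ℝ W))
  have : f = (r : Module.End ℝ W) := by
    refine (Module.finBasis ℝ W).ext fun i => ?_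
    exact hr _ (Finset.mem_image_of_mem _ (Finset.mem_univ i))
  rw [this]
  exact r.2

end Commuting

/-! ### Zariski closures and unipotent radicals -/

section Zariski

variable {W : Type*} [AddCommGroup W] [Module ℝ W]

lemma le_zariskiClosure (A : Subgroup (GLin W)) : A ≤ zariskiClosure A :=
  fun a ha _ _ h0 => h0 a ha

/-- Affine conditions pass to the Zariski closure. -/
lemma zariskiClosure_linear {A : Subgroup (GLin W)} {X : Type*} [AddCommGroup X] [Module ℝ X]
    (φ : Module.End ℝ W →ₗ[ℝ] X) (c : X) (hA : ∀ a ∈ A, φ (a : Module.End ℝ W) = c)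
    {h : GLin W} (hh : h ∈ zariskiClosure A) : φ (h : Module.End ℝ W) = c := by
  rw [← sub_eq_zero, ← Module.forall_dual_apply_eq_zero_iff ℝ]
  intro ψ
  have := hh (fun k => (ψ ∘ₗ φ) (k : Module.End ℝ W) - ψ c)
    (Subalgebra.sub_mem _ (Algebra.subset_adjoin ⟨ψ ∘ₗ φ, Or.inl rfl⟩)
      ((regularFunctions W).algebraMap_mem (ψ c))) fun a ha => by simp [hA a ha]
  simpa using this

lemma zariskiClosure_submodule {A : Subgroup (GLin W)} (Q : Submodule ℝ (Module.End ℝ W))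
    (hA : ∀ a ∈ A, (a : Module.End ℝ W) ∈ Q) {h : GLin W} (hh : h ∈ zariskiClosure A) :
    (h : Module.End ℝ W) ∈ Q := by
  rw [← Submodule.Quotient.mk_eq_zero, ← Submodule.mkQ_apply]
  exact zariskiClosure_linear Q.mkQ 0 (fun a ha => by simpa using hA a ha) hh

lemma zariskiClosure_preserves {A : Subgroup (GLin W)} (P : Submodule ℝ W)
    (hA : ∀ a ∈ A, ∀ w ∈ P, (a : Module.End ℝ W) w ∈ P) {h : GLin W}
    (hh : h ∈ zariskiClosure A) {w : W} (hw : w ∈ P) : (h : Module.End ℝ W) w ∈ P :=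
  zariskiClosure_submodule (P.comap (LinearMap.applyₗ w)) (fun a ha => hA a ha w hw) hh

variable [FiniteDimensional ℝ W]

/-- The unipotent group of a decreasing filtration. -/
def filtrationUnipotent (g : ℕ → Submodule ℝ W) (hg : Antitone g) : Subgroup (GLin W) where
  carrier := {h | ∀ k, ∀ w ∈ g k, (h : Module.End ℝ W) w - w ∈ g (k + 1)}
  one_mem' := fun k w _ => by simp
  mul_mem' := by
    intro x y hx hy k w hw
    have h1 := hy k w hw
    have h2 := hx k _ ((g k).add_mem (hg k.le_succ h1) hw)
    rw [sub_add_cancel] at h2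
    have h3 := (g (k + 1)).add_mem h2 h1
    rwa [sub_add_sub_cancel] at h3
  inv_mem' := by
    intro x hx k w hw
    let e := LinearMap.GeneralLinearGroup.generalLinearEquiv ℝ W x
    have he : ∀ v, e v = (x : Module.End ℝ W) v := fun _ => rfl
    -- Injectivity and equality of dimensions turn this inclusion into an equality, so each vector
    -- of g k is x v with v in g k.
    have hle : (g k).map (e : W →ₗ[ℝ] W) ≤ g k := by
      rintro _ ⟨v, hv, rfl⟩
      have := (g k).add_mem (hg k.le_succ (hx k v hv)) hv
      rwa [sub_add_cancel] at this
    have heq := Submodule.eq_of_le_of_finrank_eq hle (LinearEquiv.finrank_map_eq e (g k))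
    rw [← heq] at hw
    obtain ⟨v, hv, rfl⟩ := hw
    have hinv : ((x⁻¹ : GLin W) : Module.End ℝ W) ((x : Module.End ℝ W) v) = v := by
      rw [← Module.End.mul_apply, ← Units.val_mul, inv_mul_cancel, Units.val_one,
        Module.End.one_apply]
    change ((x⁻¹ : GLin W) : Module.End ℝ W) ((x : Module.End ℝ W) v)
      - (x : Module.End ℝ W) v ∈ g (k + 1)
    rw [hinv, ← neg_sub]
    exact (g (k + 1)).neg_mem (hx k v hv)

omit [FiniteDimensional ℝ W] in
lemma isNilpotent_of_lowers {g : ℕ → Submodule ℝ W} (h0 : g 0 = ⊤) {K : ℕ} (hK : g K = ⊥)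
    {f : Module.End ℝ W} (hf : ∀ k, ∀ w ∈ g k, f w ∈ g (k + 1)) : IsNilpotent f := by
  have h : ∀ k w, (f ^ k) w ∈ g k := by
    intro k
    induction k with
    | zero => simp [h0]
    | succ k ih =>
      intro w
      rw [pow_succ', Module.End.mul_apply]
      exact hf k _ (ih w)
  refine ⟨K, LinearMap.ext fun w => ?_⟩
  have := h K w
  rwa [hK, Submodule.mem_bot] at this

/-- The elements of an algebraic group which act unipotently with respect to an invariant
filtration belong to the unipotent radical. -/
lemma filtrationUnipotent_inf_le {A U : Subgroup (GLin W)} (hU : IsUnipotentRadical A U)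
    {g : ℕ → Submodule ℝ W} (hg : Antitone g) (h0 : g 0 = ⊤) {K : ℕ} (hK : g K = ⊥)
    (hA : ∀ a ∈ A, ∀ k, ∀ w ∈ g k, (a : Module.End ℝ W) w ∈ g k) :
    filtrationUnipotent g hg ⊓ A ≤ U := by
  -- Since U is the largest normal unipotent subgroup, normality and unipotence of the intersection
  -- suffice.
  refine hU.2 ⟨inf_le_right, ?_, ?_⟩
  · rintro a ha u ⟨hu, huA⟩
    refine ⟨fun k w hw => ?_, A.mul_mem (A.mul_mem ha huA) (A.inv_mem ha)⟩
    have h1 := hu k _ (hA a⁻¹ (A.inv_mem ha) k w hw)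
    have h2 := hA a ha (k + 1) _ h1
    have hinv : (a : Module.End ℝ W) (((a⁻¹ : GLin W) : Module.End ℝ W) w) = w := by
      rw [← Module.End.mul_apply, ← Units.val_mul, mul_inv_cancel, Units.val_one,
        Module.End.one_apply]
    rwa [map_sub, hinv] at h2
  · rintro u ⟨hu, -⟩
    exact isNilpotent_of_lowers h0 hK fun k w hw => hu k w hw

end Zariski

/-! ### The nilradical -/

section Nilradical

variable {L : Type*} [LieRing L] [LieAlgebra ℝ L]

/-- `I.lcs L` starts at L while the intrinsic series of I starts at I. One bracket with I lands in
I, which explains the shift by one. -/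
lemma exists_mem_lowerCentralSeries (I : LieIdeal ℝ L) (k : ℕ) {x : L}
    (hx : x ∈ I.lcs L (k + 1)) :
    ∃ y : I, y ∈ LieModule.lowerCentralSeries ℝ I I k ∧ (y : L) = x := by
  induction k generalizing x with
  | zero =>
    have : I.lcs L 1 ≤ I := by
      rw [LieIdeal.lcs_succ]
      exact LieSubmodule.lie_le_left _ _
    exact ⟨⟨x, this hx⟩, LieSubmodule.mem_top _, rfl⟩
  | succ k ih =>
    rw [LieIdeal.lcs_succ, ← LieSubmodule.mem_toSubmodule,
      LieSubmodule.lieIdeal_oper_eq_linear_span'] at hx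
    induction hx using Submodule.span_induction with
    | mem z hz =>
      obtain ⟨x, hx, m, hm, rfl⟩ := hz
      obtain ⟨y, hy, rfl⟩ := ih hm
      refine ⟨⁅(⟨x, hx⟩ : I), y⁆, ?_, rfl⟩
      rw [LieModule.lowerCentralSeries_succ]
      exact LieSubmodule.lie_mem_lie (LieSubmodule.mem_top _) hy
    | zero => exact ⟨0, zero_mem _, rfl⟩
    | add y z _ _ hy hz =>
      obtain ⟨y', hy', rfl⟩ := hy
      obtain ⟨z', hz', rfl⟩ := hz
      exact ⟨y' + z', add_mem hy' hz', rfl⟩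
    | smul r y _ hy =>
      obtain ⟨y', hy', rfl⟩ := hy
      exact ⟨r • y', Submodule.smul_mem _ r hy', rfl⟩

lemma exists_lcs_eq_bot_of_isNilpotent (I : LieIdeal ℝ L) [LieRing.IsNilpotent I] :
    ∃ k, I.lcs L k = ⊥ := by
  obtain ⟨k, hk⟩ := (LieModule.isNilpotent_iff ℝ I I).1 inferInstance
  refine ⟨k + 1, ?_⟩
  refine (LieSubmodule.eq_bot_iff _).2 fun x hx => ?_
  obtain ⟨y, hy, rfl⟩ := exists_mem_lowerCentralSeries I k hx
  rw [hk, LieSubmodule.mem_bot] at hy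
  rw [hy]
  rfl

/-- The core of Fitting's theorem. The index i counts the brackets taken with I: such a bracket
advances the series of I and, all terms being ideals, does not leave the current term of the series
of J; and vice versa. -/
lemma lcs_sup_le (I J : LieIdeal ℝ L) (k : ℕ) :
    (I ⊔ J).lcs L k ≤ ⨆ i : Fin (k + 1), I.lcs L i ⊓ J.lcs L (k - i) := by
  induction k with
  | zero => exact le_iSup_of_le 0 (by simp)
  | succ k ih =>
    rw [LieIdeal.lcs_succ]
    refine (LieSubmodule.mono_lie_right (I := I ⊔ J) ih).trans ?_
    refine (LieSubmodule.lie_le_iff _ _ _).2 fun x hx m hm => ?_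
    refine LieSubmodule.iSup_induction _ (motive := fun m => ⁅x, m⁆ ∈
      ⨆ i : Fin (k + 1 + 1), I.lcs L i ⊓ J.lcs L (k + 1 - i)) hm (fun i y hy => ?_)
      (by rw [lie_zero]; exact zero_mem _) fun y z hy hz => by rw [lie_add]; exact add_mem hy hz
    refine (?_ : ⁅I ⊔ J, I.lcs L i ⊓ J.lcs L (k - i)⁆ ≤ _) (LieSubmodule.lie_mem_lie hx hy)
    rw [LieSubmodule.sup_lie]
    refine sup_le ?_ ?_
    · refine le_iSup_of_le i.succ (le_inf ?_ ?_)
      · rw [Fin.val_succ, LieIdeal.lcs_succ]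
        exact LieSubmodule.mono_lie_right _ inf_le_left
      · rw [Fin.val_succ, Nat.add_sub_add_right]
        exact (LieSubmodule.lie_le_right _ _).trans inf_le_right
    · refine le_iSup_of_le i.castSucc (le_inf ?_ ?_)
      · exact (LieSubmodule.lie_le_right _ _).trans inf_le_left
      · rw [Fin.val_castSucc, Nat.sub_add_comm (Nat.lt_succ_iff.1 i.2), LieIdeal.lcs_succ]
        exact LieSubmodule.mono_lie_right _ inf_le_right

lemma lcs_antitone (I : LieIdeal ℝ L) : Antitone fun k => I.lcs L k :=
  antitone_nat_of_succ_le fun k => by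
    rw [LieIdeal.lcs_succ]
    exact LieSubmodule.lie_le_right _ _

/-- Among k + l brackets either at least k are with I or at least l with J. -/
lemma exists_lcs_sup_eq_bot {I J : LieIdeal ℝ L} (hI : ∃ k, I.lcs L k = ⊥)
    (hJ : ∃ k, J.lcs L k = ⊥) : ∃ k, (I ⊔ J).lcs L k = ⊥ := by
  obtain ⟨k, hk⟩ := hI
  obtain ⟨l, hl⟩ := hJ
  refine ⟨k + l, eq_bot_iff.2 ((lcs_sup_le I J (k + l)).trans (iSup_le fun i => ?_))⟩
  rcases le_total k (i : ℕ) with h | h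
  · exact inf_le_left.trans ((lcs_antitone I h).trans hk.le)
  · exact inf_le_right.trans ((lcs_antitone J (by omega)).trans hl.le)

/-- A maximal ideal with terminating series absorbs every nilpotent ideal, because such ideals are
closed under binary sums. Hence it contains the nilradical. -/
lemma exists_lcs_nilradical_eq_bot [FiniteDimensional ℝ L] :
    ∃ k, (nilradical L).lcs L k = ⊥ := by
  -- The exponent is 1 and not 0, as the series of ⊥ starts at the whole of L.
  have hne : {I : LieIdeal ℝ L | ∃ k, I.lcs L k = ⊥}.Nonempty := ⟨⊥, 1, by simp⟩
  obtain ⟨I, hI, hmax⟩ := (wellFounded_gt (α := LieIdeal ℝ L)).has_min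
    {I : LieIdeal ℝ L | ∃ k, I.lcs L k = ⊥} hne
  have hle : nilradical L ≤ I := by
    refine sSup_le fun J hJ => ?_
    have hJ' : LieRing.IsNilpotent J := hJ
    have h1 := hmax _ (exists_lcs_sup_eq_bot hI (exists_lcs_eq_bot_of_isNilpotent J))
    have h2 : I = I ⊔ J := by
      by_contra hne
      exact h1 (lt_of_le_of_ne le_sup_left hne)
    rw [h2]
    exact le_sup_right
  obtain ⟨k, hk⟩ := hI
  refine ⟨k, eq_bot_iff.2 (le_trans ?_ hk.le)⟩
  clear hk
  induction k with
  | zero => simp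
  | succ k ih =>
    rw [LieIdeal.lcs_succ, LieIdeal.lcs_succ]
    exact LieSubmodule.mono_lie hle ih

/-- A Lie algebra automorphism preserves the nilradical. -/
lemma nilradical_invariant (e : L ≃ₗ⁅ℝ⁆ L) {x : L} (hx : x ∈ nilradical L) :
    e x ∈ nilradical L := by
  suffices h : nilradical L ≤ (nilradical L).comap e.toLieHom from h hx
  refine sSup_le fun I hI => ?_
  have hI' : LieRing.IsNilpotent I := hI
  have h1 : I.map e.toLieHom ≤ nilradical L := by
    refine le_sSup ?_
    change LieRing.IsNilpotent (I.map e.toLieHom)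
    have hmem : ∀ y, y ∈ I.map e.toLieHom → ∃ z ∈ I, e z = y := fun y hy =>
      (LieIdeal.mem_map_of_surjective e.surjective hy).elim fun z hz => ⟨z, z.2, hz⟩
    let f : I →ₗ⁅ℝ⁆ I.map e.toLieHom :=
      { toFun := fun z => ⟨e z, LieIdeal.mem_map z.2⟩
        map_add' := fun a b => Subtype.ext (by simp)
        map_smul' := fun r a => Subtype.ext (by simp)
        map_lie' := fun {a b} => Subtype.ext (LieEquiv.map_lie e a.1 b.1) }
    have hf : Function.Surjective f := fun y => by
      obtain ⟨z, hz, h⟩ := hmem y y.2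
      exact ⟨⟨z, hz⟩, Subtype.ext h⟩
    exact hf.lieAlgebra_isNilpotent
  exact LieIdeal.map_le_iff_le_comap.1 h1

lemma lcs_nilradical_invariant (e : L ≃ₗ⁅ℝ⁆ L) (k : ℕ) {x : L}
    (hx : x ∈ (nilradical L).lcs L k) : e x ∈ (nilradical L).lcs L k := by
  induction k generalizing x with
  | zero => simp
  | succ k ih =>
    rw [LieIdeal.lcs_succ] at hx ⊢
    rw [← LieSubmodule.mem_toSubmodule, LieSubmodule.lieIdeal_oper_eq_linear_span'] at hx
    induction hx using Submodule.span_induction with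
    | mem y hy =>
      obtain ⟨a, ha, m, hm, rfl⟩ := hy
      rw [LieEquiv.map_lie]
      exact LieSubmodule.lie_mem_lie (nilradical_invariant e ha) (ih hm)
    | zero => simp
    | add y z _ _ hy hz => rw [map_add]; exact add_mem hy hz
    | smul r y _ hy => rw [map_smul]; exact Submodule.smul_mem _ r hy

end Nilradical

/-! ### Maps with vanishing differential -/

section Constant

open Set Filter Topology

variable {n : ℕ} {M : Type*} [TopologicalSpace M] [ChartedSpace (EuclideanSpace ℝ (Fin n)) M]
  {E' H' : Type*} [NormedAddCommGroup E'] [NormedSpace ℝ E'] [TopologicalSpace H']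
  {I' : ModelWithCorners ℝ E' H'} {M' : Type*} [TopologicalSpace M'] [ChartedSpace H' M']

/-- A map with vanishing differential is locally constant. -/
lemma isLocallyConstant_of_mfderiv_eq_zero [IsManifold (𝓡 n) ∞ M] [IsManifold I' ∞ M']
    {f : M → M'} (hf : MDifferentiable (𝓡 n) I' f)
    (h0 : ∀ x, mfderiv (𝓡 n) I' f x = 0) : IsLocallyConstant f := by
  refine (IsLocallyConstant.iff_eventually_eq f).2 fun x => ?_
  have : IsManifold (𝓡 n) 1 M := IsManifold.of_le (n := ∞) (by simp)
  have : IsManifold I' 1 M' := IsManifold.of_le (n := ∞) (by simp)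
  let φ := extChartAt (𝓡 n) x
  let ψ := extChartAt I' (f x)
  have hU : φ.target ∩ φ.symm ⁻¹' (f ⁻¹' ψ.source) ∈ 𝓝 (φ x) := by
    refine inter_mem (extChartAt_target_mem_nhds x) ?_
    refine (continuousAt_extChartAt_symm x).preimage_mem_nhds ?_
    rw [extChartAt_to_inv]
    exact (hf x).continuousAt.preimage_mem_nhds (extChartAt_source_mem_nhds (f x))
  obtain ⟨r, hr, hball⟩ := Metric.mem_nhds_iff.1 hU
  let g : EuclideanSpace ℝ (Fin n) → E' := ψ ∘ f ∘ φ.symm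
  have hg : ∀ y ∈ Metric.ball (φ x) r, HasFDerivAt g (0 : EuclideanSpace ℝ (Fin n) →L[ℝ] E') y := by
    intro y hy
    obtain ⟨hy1, hy2⟩ := hball hy
    have d1 : MDifferentiableAt 𝓘(ℝ, EuclideanSpace ℝ (Fin n)) (𝓡 n) φ.symm y :=
      (mdifferentiableOn_extChartAt_symm y hy1).mdifferentiableAt
        ((isOpen_extChartAt_target x).mem_nhds hy1)
    have d2 : MDifferentiableAt I' 𝓘(ℝ, E') ψ (f (φ.symm y)) :=
      mdifferentiableAt_extChartAt (by rwa [← extChartAt_source I'])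
    have d3 := d2.hasMFDerivAt.comp y ((hf (φ.symm y)).hasMFDerivAt.comp y d1.hasMFDerivAt)
    rw [h0] at d3
    have d4 : HasMFDerivAt 𝓘(ℝ, EuclideanSpace ℝ (Fin n)) 𝓘(ℝ, E') g y 0 := by
      convert d3 using 1
      ext v
      simp
    exact d4.hasFDerivAt
  have hconst : ∀ y ∈ Metric.ball (φ x) r, g y = g (φ x) := fun y hy =>
    (convex_ball (φ x) r).is_const_of_fderivWithin_eq_zero
      (fun z hz => (hg z hz).differentiableAt.differentiableWithinAt)
      (fun z hz => by
        rw [fderivWithin_of_isOpen Metric.isOpen_ball hz, (hg z hz).fderiv])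
      hy (Metric.mem_ball_self hr)
  have hev : ∀ᶠ y in 𝓝 x, y ∈ φ.source ∧ φ y ∈ Metric.ball (φ x) r :=
    Filter.Eventually.and (extChartAt_source_mem_nhds x)
      ((continuousAt_extChartAt x).preimage_mem_nhds (Metric.ball_mem_nhds _ hr))
  filter_upwards [hev] with y ⟨hy1, hy2⟩
  have h1 := hconst _ hy2
  simp only [g, Function.comp_apply, φ.left_inv hy1, extChartAt_to_inv, φ] at h1
  have h2 := (hball hy2).2
  simp only [mem_preimage, φ.left_inv hy1] at h2
  exact ψ.injOn h2 (mem_extChartAt_source (f x)) h1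

lemma eq_of_mfderiv_eq_zero [IsManifold (𝓡 n) ∞ M] [IsManifold I' ∞ M'] [PreconnectedSpace M]
    {f : M → M'} (hf : MDifferentiable (𝓡 n) I' f)
    (h0 : ∀ x, mfderiv (𝓡 n) I' f x = 0) (x y : M) : f x = f y :=
  (isLocallyConstant_of_mfderiv_eq_zero hf h0).apply_eq_of_preconnectedSpace x y

end Constant

/-! ### Equivariant maps are controlled by their differential at the identity -/

section Equivariant

variable {n : ℕ} {G : Type*} [TopologicalSpace G] [ChartedSpace (EuclideanSpace ℝ (Fin n)) G]
  [Group G] [LieGroup (𝓡 n) ∞ G]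
  {E' H' : Type*} [NormedAddCommGroup E'] [NormedSpace ℝ E'] [TopologicalSpace H']
  {I' : ModelWithCorners ℝ E' H'} {M' : Type*} [TopologicalSpace M'] [ChartedSpace H' M']

lemma mdifferentiable_mul_left (a : G) : MDifferentiable (𝓡 n) (𝓡 n) fun x : G => a * x :=
  (contMDiff_mul_left (I := 𝓡 n) (n := ∞) (a := a)).mdifferentiable (by simp)

/-- A map on a connected Lie group which intertwines left translations with differentiable maps is
constant if its differential at the identity vanishes. -/
lemma eq_of_mfderiv_one_eq_zero [IsManifold I' ∞ M'] [PreconnectedSpace G] {f : G → M'}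
    (hf : MDifferentiable (𝓡 n) I' f) {Λ : G → M' → M'}
    (hΛ : ∀ a, MDifferentiable I' I' (Λ a)) (hfΛ : ∀ a x, f (a * x) = Λ a (f x))
    (h0 : mfderiv (𝓡 n) I' f 1 = 0) (x : G) : f x = f 1 := by
  have : IsManifold (𝓡 n) ∞ G := inferInstance
  refine eq_of_mfderiv_eq_zero hf (fun a => ?_) x 1
  -- This factorization sends a to 1 first, so the differential at a factors through the vanishing
  -- differential at 1.
  have h1 : f = Λ a ∘ f ∘ fun y => a⁻¹ * y := by
    funext y
    simp [← hfΛ]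
  have d1 := (mdifferentiable_mul_left (n := n) a⁻¹ a).hasMFDerivAt
  have d2 : HasMFDerivAt (𝓡 n) I' f (a⁻¹ * a) 0 := by
    rw [inv_mul_cancel, ← h0]
    exact (hf 1).hasMFDerivAt
  have d3 := ((hΛ a) (f (a⁻¹ * a))).hasMFDerivAt.comp a (d2.comp a d1)
  have d4 := d3.mfderiv
  rw [← h1] at d4
  rw [d4]
  ext v
  exact (mfderiv I' I' (Λ a) (f (a⁻¹ * a))).map_zero

end Equivariant

/-! ### Representations are determined by their differential -/

section Representations

variable {n : ℕ} {G : Type*} [TopologicalSpace G] [ChartedSpace (EuclideanSpace ℝ (Fin n)) G]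
  {A : Type*} [NormedRing A] [NormedAlgebra ℝ A]

lemma hasMFDerivAt_mul_const_mul {f g : G → A} {x : G}
    {f' g' : EuclideanSpace ℝ (Fin n) →L[ℝ] A} (hf : HasMFDerivAt (𝓡 n) 𝓘(ℝ, A) f x f')
    (hg : HasMFDerivAt (𝓡 n) 𝓘(ℝ, A) g x g') (c : A) :
    ∃ D : EuclideanSpace ℝ (Fin n) →L[ℝ] A,
      HasMFDerivAt (𝓡 n) 𝓘(ℝ, A) (fun y => f y * c * g y) x D ∧
      ∀ v, D v = f' v * c * g x + f x * c * g' v := by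
  have h1 := (hf.mul' (hasMFDerivAt_const c x)).mul' hg
  refine ⟨_, h1, fun v => ?_⟩
  change f x * c * g' v + (f x * (0 : A) + f' v * c) * g x = _
  rw [mul_zero, zero_add, add_comm]

variable [Group G] [LieGroup (𝓡 n) ∞ G]

/-- Differentiating R(a) R(a⁻¹) = 1 at the identity avoids computing the differential of inversion
on G. -/
lemma hasMFDerivAt_inv_hom {R : G →* A} {D : EuclideanSpace ℝ (Fin n) →L[ℝ] A}
    (hR : HasMFDerivAt (𝓡 n) 𝓘(ℝ, A) R 1 D) :
    HasMFDerivAt (𝓡 n) 𝓘(ℝ, A) (fun a => R a⁻¹) 1 (-D) := by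
  have h1 : MDifferentiableAt (𝓡 n) (𝓡 n) (fun a : G => a⁻¹) 1 :=
    (contMDiff_inv (𝓡 n) ∞).mdifferentiable (by simp) 1
  have h2 : HasMFDerivAt (𝓡 n) 𝓘(ℝ, A) R ((1 : G)⁻¹) D := by rwa [inv_one]
  have h3 := h2.comp (1 : G) h1.hasMFDerivAt
  obtain ⟨D', h4, h5⟩ := hasMFDerivAt_mul_const_mul hR h3 1
  have h6 : (fun y => R y * 1 * (R ∘ fun a => a⁻¹) y) = fun _ => 1 := by
    funext y
    simp [← map_mul]
  rw [h6] at h4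
  have h7 := hasMFDerivAt_unique h4 (hasMFDerivAt_const 1 (1 : G))
  have h9 : (-D) = D.comp (mfderiv (𝓡 n) (𝓡 n) (fun a : G => a⁻¹) 1) := by
    ext v
    have h8 := h5 v
    rw [h7] at h8
    refine neg_eq_of_add_eq_zero_right (Eq.trans ?_ h8.symm)
    simp
    rfl
  rw [h9]
  exact h3

/-- An element which intertwines the differentials of two representations of a connected Lie group
intertwines the representations. -/
lemma intertwines_of_differential [PreconnectedSpace G] {R₁ R₂ : G →* A}
    (h₁ : MDifferentiable (𝓡 n) 𝓘(ℝ, A) R₁) (h₂ : MDifferentiable (𝓡 n) 𝓘(ℝ, A) R₂)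
    {D₁ D₂ : EuclideanSpace ℝ (Fin n) →L[ℝ] A} (hD₁ : HasMFDerivAt (𝓡 n) 𝓘(ℝ, A) R₁ 1 D₁)
    (hD₂ : HasMFDerivAt (𝓡 n) 𝓘(ℝ, A) R₂ 1 D₂) {c : A} (hc : ∀ v, D₁ v * c = c * D₂ v) (a : G) :
    R₁ a * c = c * R₂ a := by
  have hinv : MDifferentiable (𝓡 n) (𝓡 n) (fun a : G => a⁻¹) :=
    (contMDiff_inv (𝓡 n) ∞).mdifferentiable (by simp)
  -- The differential of x ↦ R₁(x) c R₂(x⁻¹) at 1 is v ↦ D₁(v) c - c D₂(v) = 0, so this map is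
  -- constant with value c.
  have key := eq_of_mfderiv_one_eq_zero (n := n) (G := G) (I' := 𝓘(ℝ, A))
    (f := fun x => R₁ x * c * R₂ x⁻¹)
    (Λ := fun a y => R₁ a * y * R₂ a⁻¹) ?_ ?_ ?_ ?_ a
  · have h := congrArg (· * R₂ a) key
    simpa [mul_assoc, ← map_mul] using h
  · intro x
    obtain ⟨D, hD, -⟩ := hasMFDerivAt_mul_const_mul (h₁ x).hasMFDerivAt
      ((h₂ x⁻¹).comp x (hinv x)).hasMFDerivAt c
    exact hD.mdifferentiableAt
  · intro a
    exact Differentiable.mdifferentiable (by fun_prop)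
  · intro a x
    simp [mul_assoc]
  · obtain ⟨D, hD, h⟩ := hasMFDerivAt_mul_const_mul hD₁ (hasMFDerivAt_inv_hom hD₂) c
    rw [hD.mfderiv]
    ext v
    refine (h v).trans ?_
    simp [hc]
    rfl

/-- The differential of a representation at an arbitrary point. -/
lemma mfderiv_hom_mul {R : G →* A} {D : EuclideanSpace ℝ (Fin n) →L[ℝ] A}
    (hD : HasMFDerivAt (𝓡 n) 𝓘(ℝ, A) R 1 D) (hR : MDifferentiable (𝓡 n) 𝓘(ℝ, A) R) (a : G)
    (v : Lie n G) : mfderiv (𝓡 n) 𝓘(ℝ, A) R a (mulInvariantVectorField v a) = R a * D v := by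
  have h1 : R ∘ (fun x => a * x) = fun x => R a * R x := by
    funext x
    simp
  have d1 : HasMFDerivAt (𝓡 n) 𝓘(ℝ, A) R (a * 1) (mfderiv (𝓡 n) 𝓘(ℝ, A) R a) := by
    rw [mul_one]
    exact (hR a).hasMFDerivAt
  have d2 := d1.comp (1 : G) (mdifferentiable_mul_left (n := n) a 1).hasMFDerivAt
  rw [h1] at d2
  have d3 := (hasMFDerivAt_const (R a) (1 : G) (I := 𝓡 n) (I' := 𝓘(ℝ, A))).mul' hD
  have d4 := hasMFDerivAt_unique d2 d3
  have d5 := congrArg (fun L : EuclideanSpace ℝ (Fin n) →L[ℝ] A => L v) d4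
  refine d5.trans ?_
  change R a * D v + (0 : A) * R 1 = _
  rw [zero_mul, add_zero]

end Representations
-- Homomorphisms of Lie groups and their differentials
section LieGroupMaps

variable {n : ℕ} {G : Type*} [TopologicalSpace G] [ChartedSpace (EuclideanSpace ℝ (Fin n)) G]
  [Group G] [LieGroup (𝓡 n) ∞ G]

/-- Homomorphisms of a connected Lie group are determined by their differential. -/
lemma hom_eq_of_lieMap_eq [PreconnectedSpace G] {f g : G →* G}
    (hf : MDifferentiable (𝓡 n) (𝓡 n) f) (hg : MDifferentiable (𝓡 n) (𝓡 n) g)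
    (h : lieMap (n := n) f = lieMap g) : f = g := by
  have hm : MDifferentiable ((𝓡 n).prod (𝓡 n)) (𝓡 n) fun q : G × G => q.1 * q.2⁻¹ :=
    (contMDiff_fst.mul contMDiff_snd.inv : ContMDiff ((𝓡 n).prod (𝓡 n)) (𝓡 n) ∞
      fun q : G × G => q.1 * q.2⁻¹).mdifferentiable (by simp)
  have hd : HasMFDerivAt (𝓡 n) (𝓡 n) g 1 (mfderiv (𝓡 n) (𝓡 n) f 1) := by
    have h1 : mfderiv (𝓡 n) (𝓡 n) g 1 = mfderiv (𝓡 n) (𝓡 n) f 1 := by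
      ext v : 1
      exact (LinearMap.congr_fun h v).symm
    rw [← h1]
    exact (hg 1).hasMFDerivAt
  have key := eq_of_mfderiv_one_eq_zero (n := n) (G := G) (I' := 𝓡 n)
    (f := fun x => f x * (g x)⁻¹) (Λ := fun a y => f a * y * (g a)⁻¹) ?_ ?_ ?_ ?_
  · ext x
    have := key x
    simpa [mul_inv_eq_one] using this
  · exact fun x => (hm (f x, g x)).comp x ((hf x).prodMk (hg x))
  · intro a
    exact ((contMDiff_const.mul contMDiff_id).mul contMDiff_const :
      ContMDiff (𝓡 n) (𝓡 n) ∞ fun y => f a * y * (g a)⁻¹).mdifferentiable (by simp)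
  · intro a x
    simp [mul_assoc]
  · have e1 : (1 : G) = g 1 := (map_one g).symm
    have e2 : (1 : G) = f 1 := (map_one f).symm
    have m1 := (hm (1, 1)).hasMFDerivAt
    have m2 : HasMFDerivAt ((𝓡 n).prod (𝓡 n)) (𝓡 n) (fun q : G × G => q.1 * q.2⁻¹) (f 1, g 1)
        (mfderiv ((𝓡 n).prod (𝓡 n)) (𝓡 n) (fun q : G × G => q.1 * q.2⁻¹) (1, 1)) := by
      rw [map_one, map_one]
      exact m1
    have m3 : HasMFDerivAt ((𝓡 n).prod (𝓡 n)) (𝓡 n) (fun q : G × G => q.1 * q.2⁻¹) (f 1, f 1)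
        (mfderiv ((𝓡 n).prod (𝓡 n)) (𝓡 n) (fun q : G × G => q.1 * q.2⁻¹) (1, 1)) := by
      rw [map_one]
      exact m1
    have d1 := m2.comp (1 : G) ((hf 1).hasMFDerivAt.prodMk hd)
    have d2 := m3.comp (1 : G) ((hf 1).hasMFDerivAt.prodMk (hf 1).hasMFDerivAt)
    -- As f and g have the same differential at 1, the differentials of f · g⁻¹ and of f · f⁻¹ = 1
    -- agree there. No formula for the differential of (x, y) ↦ x y⁻¹ is needed.
    have e : (fun q : G × G => q.1 * q.2⁻¹) ∘ (fun x => (f x, f x)) = fun _ => 1 := by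
      funext x
      simp
    rw [e] at d2
    have d3 := hasMFDerivAt_unique d2 (hasMFDerivAt_const 1 (1 : G))
    exact d1.mfderiv.trans d3

/-- The differential at `1` of a smooth family of maps fixing `1` depends smoothly on the
parameter. -/
lemma contMDiff_mfderiv_family {Φ : G → G → G}
    (hΦ : ContMDiff ((𝓡 n).prod (𝓡 n)) (𝓡 n) ∞ (fun q : G × G => Φ q.1 q.2))
    (h1 : ∀ a, Φ a 1 = 1) :
    ContMDiff (𝓡 n) 𝓘(ℝ, EuclideanSpace ℝ (Fin n) →L[ℝ] EuclideanSpace ℝ (Fin n)) ∞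
      (fun a => show EuclideanSpace ℝ (Fin n) →L[ℝ] EuclideanSpace ℝ (Fin n) from
        mfderiv (𝓡 n) (𝓡 n) (Φ a) 1) := by
  intro a
  have h := ContMDiffAt.mfderiv (x₀ := a) Φ (fun _ => 1) (hΦ (a, 1)) (contMDiffAt_const)
    (m := ∞) (by simp)
  refine h.congr_of_eventuallyEq (Filter.Eventually.of_forall fun b => ?_)
  -- Smoothness is known in tangent coordinates. All base points involved equal 1, so the coordinate
  -- changes are the identity and the coordinates can be dropped.
  have e : ∀ x y z : G, x = 1 → y = 1 → z = 1 → ∀ w : EuclideanSpace ℝ (Fin n),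
      (tangentBundleCore (𝓡 n) G).coordChange (achart _ x) (achart _ y) z w = w := by
    rintro x y z rfl rfl rfl w
    exact (tangentBundleCore (𝓡 n) G).coordChange_self _ _ (mem_chart_source _ _) _
  have hc := inTangentCoordinates_eq (I := 𝓡 n) (I' := 𝓡 n) (fun _ : G => (1 : G))
    (fun x => Φ x 1) (fun x => mfderiv (𝓡 n) (𝓡 n) (Φ x) 1) (x₀ := a) (x := b)
    (mem_chart_source _ _) (by rw [h1, h1]; exact mem_chart_source _ _)
  refine Eq.trans ?_ hc.symm
  ext v : 1
  refine Eq.symm ((e _ _ _ (h1 b) (h1 a) (h1 b) _).trans ?_)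
  exact congrArg _ (e _ _ _ rfl rfl rfl v)

lemma mfderiv_mulInvariantVectorField {f : G →* G} (hf : MDifferentiable (𝓡 n) (𝓡 n) f)
    (v : Lie n G) (g : G) :
    mfderiv (𝓡 n) (𝓡 n) f g (mulInvariantVectorField v g) =
      mulInvariantVectorField (lieMap f v : Lie n G) (f g) := by
  have h : f ∘ (fun x => g * x) = (fun x => f g * x) ∘ f := by
    funext x
    simp
  have d1 : HasMFDerivAt (𝓡 n) (𝓡 n) f (g * 1) (mfderiv (𝓡 n) (𝓡 n) f g) := by
    rw [mul_one]
    exact (hf g).hasMFDerivAt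
  have d2 := d1.comp (1 : G) (mdifferentiable_mul_left (n := n) g 1).hasMFDerivAt
  have d3 : HasMFDerivAt (𝓡 n) (𝓡 n) (fun x => f g * x) (f 1)
      (mfderiv (𝓡 n) (𝓡 n) (fun x => f g * x) 1) := by
    rw [map_one]
    exact (mdifferentiable_mul_left (n := n) (f g) 1).hasMFDerivAt
  have d4 := d3.comp (1 : G) (hf 1).hasMFDerivAt
  rw [h] at d2
  exact congrArg (fun L : EuclideanSpace ℝ (Fin n) →L[ℝ] EuclideanSpace ℝ (Fin n) => L v)
    (hasMFDerivAt_unique d2 d4)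

/-- The differential of a smooth automorphism is a Lie algebra homomorphism. -/
lemma lieMap_lie {f g : G →* G} (hf : ContMDiff (𝓡 n) (𝓡 n) ∞ f)
    (hg : ContMDiff (𝓡 n) (𝓡 n) ∞ g) (hfg : ∀ x, f (g x) = x) (hgf : ∀ x, g (f x) = x)
    (u v : Lie n G) :
    (lieMap f ⁅u, v⁆ : Lie n G) = ⁅(lieMap f u : Lie n G), (lieMap f v : Lie n G)⁆ := by
  have hf' := hf.mdifferentiable (n := ∞) (by simp)
  have hg' := hg.mdifferentiable (n := ∞) (by simp)
  have hinv : ∀ x, (mfderiv (𝓡 n) (𝓡 n) f x).IsInvertible := by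
    intro x
    have i1 := (hg' (f x)).hasMFDerivAt.comp x (hf' x).hasMFDerivAt
    rw [show (g ∘ f : G → G) = id from funext hgf] at i1
    have h2 : HasMFDerivAt (𝓡 n) (𝓡 n) f (g (f x)) (mfderiv (𝓡 n) (𝓡 n) f x) := by
      rw [hgf]
      exact (hf' x).hasMFDerivAt
    have i2 := h2.comp (f x) (hg' (f x)).hasMFDerivAt
    rw [show (f ∘ g : G → G) = id from funext hfg] at i2
    exact .of_inverse (hasMFDerivAt_unique i2 (hasMFDerivAt_id _))
      (hasMFDerivAt_unique i1 (hasMFDerivAt_id _))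
  -- The automorphism pulls left invariant fields back to left invariant fields, and pullback
  -- commutes with the bracket; it remains to evaluate at 1.
  have hpull : ∀ w : Lie n G, VectorField.mpullback (𝓡 n) (𝓡 n) f
      (mulInvariantVectorField (lieMap f w : Lie n G)) = mulInvariantVectorField w := by
    intro w
    funext x
    rw [VectorField.mpullback_apply, ← mfderiv_mulInvariantVectorField hf',
      ← ContinuousLinearMap.comp_apply, (hinv x).inverse_comp_self]
    rfl
  have key := VectorField.mpullback_mlieBracket (I := 𝓡 n) (I' := 𝓡 n) (f := f) (x₀ := (1 : G))
    (n := ∞)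
    (V := mulInvariantVectorField (lieMap f u : Lie n G))
    (W := mulInvariantVectorField (lieMap f v : Lie n G))
    (mdifferentiableAt_mulInvariantVectorField _) (mdifferentiableAt_mulInvariantVectorField _)
    (hf 1) (by rw [minSmoothness_of_isRCLikeNormedField]; exact WithTop.coe_le_coe.2 le_top)
  rw [hpull, hpull, VectorField.mpullback_apply] at key
  have h1 := congrArg (mfderiv (𝓡 n) (𝓡 n) f 1) key
  rw [← ContinuousLinearMap.comp_apply, (hinv 1).self_comp_inverse] at h1
  refine h1.symm.trans ?_
  rw [map_one]
  rfl

end LieGroupMaps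

/-! ### The differential of the adjoint representation -/

section AdjointCalculus

open Filter Topology

lemma hasFDerivAt_family {E : Type*} [NormedAddCommGroup E] [NormedSpace ℝ E] {μ : E × E → E}
    {e : E} (hμ : ContDiffAt ℝ ∞ μ (e, e)) {c : E → E × E} {c' : E →L[ℝ] E × E}
    (hc : HasFDerivAt c c' e) (hce : c e = (e, e)) :
    HasFDerivAt (fun x => fderiv ℝ μ (c x)) ((fderiv ℝ (fderiv ℝ μ) (e, e)).comp c') e := by
  have h1 : DifferentiableAt ℝ (fderiv ℝ μ) (e, e) :=
    (hμ.fderiv_right (m := ∞) (by simp)).differentiableAt (by simp)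
  have h2 : HasFDerivAt (fderiv ℝ μ) (fderiv ℝ (fderiv ℝ μ) (e, e)) (c e) := by
    rw [hce]
    exact h1.hasFDerivAt
  exact h2.comp e hc

/-- The Lie bracket of the left invariant vector fields of a local Lie group. -/
lemma differential_eq_lieBracket {E : Type*} [NormedAddCommGroup E] [NormedSpace ℝ E]
    {μ : E × E → E} {e : E} (hμ : ContDiffAt ℝ ∞ μ (e, e)) (h1 : ∀ᶠ x in 𝓝 e, μ (x, e) = x)
    (h2 : ∀ᶠ x in 𝓝 e, μ (e, x) = x) {A : E → E →L[ℝ] E} {D : E →L[ℝ] E →L[ℝ] E}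
    (hA : HasFDerivAt A D e) (hA1 : A e = 1)
    (hcomm : ∀ᶠ x in 𝓝 e, ∀ v, fderiv ℝ μ (x, e) (0, v) = fderiv ℝ μ (e, x) (A x v, 0)) (u v : E) :
    VectorField.lieBracket ℝ (fun x => fderiv ℝ μ (x, e) (0, u))
      (fun x => fderiv ℝ μ (x, e) (0, v)) e = D u v := by
  have d1 : HasFDerivAt (fun x : E => (x, e)) (ContinuousLinearMap.inl ℝ E E) e :=
    (hasFDerivAt_id e).prodMk (hasFDerivAt_const e e)
  have d2 : HasFDerivAt (fun x : E => (e, x)) (ContinuousLinearMap.inr ℝ E E) e :=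
    (hasFDerivAt_const e e).prodMk (hasFDerivAt_id e)
  have hμd : HasFDerivAt μ (fderiv ℝ μ (e, e)) (e, e) :=
    (hμ.differentiableAt (by simp)).hasFDerivAt
  have i1 : ∀ w, fderiv ℝ μ (e, e) (w, 0) = w := fun w => by
    have := ((HasFDerivAt.comp (g := μ) (f := fun x => (x, e)) e hμd d1).unique
      ((hasFDerivAt_id e).congr_of_eventuallyEq h1))
    exact DFunLike.congr_fun this w
  have i2 : ∀ w, fderiv ℝ μ (e, e) (0, w) = w := fun w => by
    have := ((HasFDerivAt.comp (g := μ) (f := fun x => (e, x)) e hμd d2).unique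
      ((hasFDerivAt_id e).congr_of_eventuallyEq h2))
    exact DFunLike.congr_fun this w
  have f1 : ∀ w, HasFDerivAt (fun x => fderiv ℝ μ (x, e) (0, w))
      (((ContinuousLinearMap.apply ℝ E ((0, w) : E × E))).comp
        ((fderiv ℝ (fderiv ℝ μ) (e, e)).comp (ContinuousLinearMap.inl ℝ E E))) e := fun w =>
    (ContinuousLinearMap.apply ℝ E ((0, w) : E × E)).hasFDerivAt.comp e
      (hasFDerivAt_family hμ d1 rfl)
  have f2 : HasFDerivAt (fun x => fderiv ℝ μ (e, x) (A x v, 0)) _ e :=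
    (hasFDerivAt_family hμ d2 rfl).clm_apply
      ((ContinuousLinearMap.inl ℝ E E).hasFDerivAt.comp e
        ((ContinuousLinearMap.apply ℝ E v).hasFDerivAt.comp e hA))
  -- Differentiating `hcomm` at e in the direction u gives D²μ((u,0),(0,v)) = D²μ((0,u),(v,0)) + D u
  -- v. The bracket is D²μ((u,0),(0,v)) - D²μ((v,0),(0,u)), so symmetry of D²μ leaves D u v.
  have f3 := (f1 v).unique (f2.congr_of_eventuallyEq (hcomm.mono fun x hx => hx v))
  have f4 := DFunLike.congr_fun f3 u
  have hsymm := (hμ.isSymmSndFDerivAt (n := ∞)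
    (by rw [minSmoothness_of_isRCLikeNormedField]; exact WithTop.coe_le_coe.2 le_top)) (u, 0) (0, v)
  have hsymm' := (hμ.isSymmSndFDerivAt (n := ∞)
    (by rw [minSmoothness_of_isRCLikeNormedField]; exact WithTop.coe_le_coe.2 le_top)) (v, 0) (0, u)
  simp [hA1, i1] at f4
  rw [VectorField.lieBracket, (f1 v).fderiv, (f1 u).fderiv, i2, i2]
  simp only [ContinuousLinearMap.comp_apply, ContinuousLinearMap.apply_apply,
    ContinuousLinearMap.inl_apply]
  rw [f4, hsymm']
  abel

end AdjointCalculus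

section AdjointDifferential

open Filter Topology

variable {n : ℕ} {G : Type*} [TopologicalSpace G] [ChartedSpace (EuclideanSpace ℝ (Fin n)) G]

lemma hasFDerivAt_of_mdifferentiableAt {F : Type*} [NormedAddCommGroup F] [NormedSpace ℝ F]
    {f : G → F} {x : G} {f' : EuclideanSpace ℝ (Fin n) →L[ℝ] F}
    (hf : HasMFDerivAt (𝓡 n) 𝓘(ℝ, F) f x f') :
    HasFDerivAt (f ∘ (extChartAt (𝓡 n) x).symm) f' (extChartAt (𝓡 n) x x) := by
  have : HasFDerivWithinAt (f ∘ (extChartAt (𝓡 n) x).symm) f' (Set.range (𝓡 n))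
    (extChartAt (𝓡 n) x x) := hf.2
  rw [ModelWithCorners.Boundaryless.range_eq_univ, hasFDerivWithinAt_univ] at this
  exact this

variable [Group G] [LieGroup (𝓡 n) ∞ G]

variable (n G) in
/-- The adjoint representation, with values in the Banach algebra of endomorphisms. -/
noncomputable def AdCLM : G →* (EuclideanSpace ℝ (Fin n) →L[ℝ] EuclideanSpace ℝ (Fin n)) where
  toFun g := mfderiv (𝓡 n) (𝓡 n) (fun x : G => g * x * g⁻¹) 1
  map_one' := by
    ext v : 1
    exact LinearMap.congr_fun (congrArg Units.val (map_one (Ad n G))) v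
  map_mul' g h := by
    ext v : 1
    exact LinearMap.congr_fun (congrArg Units.val (map_mul (Ad n G) g h)) v

lemma contMDiff_AdCLM : ContMDiff (𝓡 n)
    𝓘(ℝ, EuclideanSpace ℝ (Fin n) →L[ℝ] EuclideanSpace ℝ (Fin n)) ∞ (AdCLM n G) := by
  have h : ContMDiff ((𝓡 n).prod (𝓡 n)) (𝓡 n) ∞ (fun q : G × G => q.1 * q.2 * q.1⁻¹) :=
    (contMDiff_fst.mul contMDiff_snd).mul contMDiff_fst.inv
  exact contMDiff_mfderiv_family (Φ := fun g x => g * x * g⁻¹) h (by simp)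

end AdjointDifferential
section AdjointBracket

open Filter Topology

variable {n : ℕ} {G : Type*} [TopologicalSpace G] [ChartedSpace (EuclideanSpace ℝ (Fin n)) G]
  [Group G] [LieGroup (𝓡 n) ∞ G]

variable (n G) in
/-- The multiplication in the chart at `1`. -/
noncomputable def chartMul (q : EuclideanSpace ℝ (Fin n) × EuclideanSpace ℝ (Fin n)) :
    EuclideanSpace ℝ (Fin n) :=
  extChartAt (𝓡 n) (1 : G)
    ((extChartAt (𝓡 n) (1 : G)).symm q.1 * (extChartAt (𝓡 n) (1 : G)).symm q.2)

variable (n G) in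
/-- The coordinates of `1` in the chart at `1`. -/
noncomputable def chartOne : EuclideanSpace ℝ (Fin n) := extChartAt (𝓡 n) (1 : G) 1

omit [LieGroup (𝓡 n) ∞ G] in
lemma chart_symm_one : (extChartAt (𝓡 n) (1 : G)).symm (chartOne n G) = 1 :=
  extChartAt_to_inv _

lemma contDiffAt_chartMul : ContDiffAt ℝ ∞ (chartMul n G) (chartOne n G, chartOne n G) := by
  rw [← contMDiffAt_iff_contDiffAt]
  have h1 : ContMDiffAt 𝓘(ℝ, EuclideanSpace ℝ (Fin n)) (𝓡 n) ∞
      (extChartAt (𝓡 n) (1 : G)).symm (chartOne n G) :=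
    (contMDiffOn_extChartAt_symm (1 : G)).contMDiffAt (extChartAt_target_mem_nhds (1 : G))
  have h2 : ContMDiffAt (𝓡 n) 𝓘(ℝ, EuclideanSpace ℝ (Fin n)) ∞ (extChartAt (𝓡 n) (1 : G))
      ((extChartAt (𝓡 n) (1 : G)).symm (chartOne n G) *
        (extChartAt (𝓡 n) (1 : G)).symm (chartOne n G)) := by
    rw [chart_symm_one, mul_one]
    exact contMDiffAt_extChartAt
  have h3 : ContMDiffAt 𝓘(ℝ, EuclideanSpace ℝ (Fin n) × EuclideanSpace ℝ (Fin n)) (𝓡 n) ∞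
      (fun q : EuclideanSpace ℝ (Fin n) × EuclideanSpace ℝ (Fin n) =>
        (extChartAt (𝓡 n) (1 : G)).symm q.1 * (extChartAt (𝓡 n) (1 : G)).symm q.2)
      (chartOne n G, chartOne n G) :=
    (ContMDiffAt.comp (chartOne n G, chartOne n G) h1 contDiffAt_fst.contMDiffAt).mul
      (ContMDiffAt.comp (chartOne n G, chartOne n G) h1 contDiffAt_snd.contMDiffAt)
  exact ContMDiffAt.comp (chartOne n G, chartOne n G) h2 h3

omit [LieGroup (𝓡 n) ∞ G] in
lemma eventually_mem_target : ∀ᶠ x in 𝓝 (chartOne n G), x ∈ (extChartAt (𝓡 n) (1 : G)).target :=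
  extChartAt_target_mem_nhds (1 : G)

lemma eventually_differentiableAt_chartMul {c : EuclideanSpace ℝ (Fin n) →
      EuclideanSpace ℝ (Fin n) × EuclideanSpace ℝ (Fin n)} (hc : Continuous c)
    (h : c (chartOne n G) = (chartOne n G, chartOne n G)) :
    ∀ᶠ x in 𝓝 (chartOne n G), DifferentiableAt ℝ (chartMul n G) (c x) := by
  have h1 := (contDiffAt_chartMul (n := n) (G := G)).of_le (m := 1) (by simp)
  have h2 := (h1.eventually (by simp)).mono fun q hq => hq.differentiableAt (by simp)
  rw [← h] at h2
  exact hc.continuousAt.eventually h2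

/-- A left invariant vector field in the chart at `1`. -/
lemma mulInvariantVectorField_chart {x : EuclideanSpace ℝ (Fin n)}
    (hx : x ∈ (extChartAt (𝓡 n) (1 : G)).target)
    (hd : DifferentiableAt ℝ (chartMul n G) (x, chartOne n G)) (v : Lie n G) :
    mfderiv (𝓡 n) 𝓘(ℝ, EuclideanSpace ℝ (Fin n)) (extChartAt (𝓡 n) (1 : G))
      ((extChartAt (𝓡 n) (1 : G)).symm x)
      (mulInvariantVectorField v ((extChartAt (𝓡 n) (1 : G)).symm x)) =
    fderiv ℝ (chartMul n G) (x, chartOne n G) (0, v) := by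
  set φ := extChartAt (𝓡 n) (1 : G) with hφ
  have hs : φ.symm x ∈ φ.source := φ.map_target hx
  have d1 : HasMFDerivAt (𝓡 n) 𝓘(ℝ, EuclideanSpace ℝ (Fin n)) φ (φ.symm x * 1)
      (mfderiv (𝓡 n) 𝓘(ℝ, EuclideanSpace ℝ (Fin n)) φ (φ.symm x)) := by
    rw [mul_one]
    exact (mdifferentiableAt_extChartAt (by rwa [← extChartAt_source (𝓡 n)])).hasMFDerivAt
  have d2 := hasFDerivAt_of_mdifferentiableAt
    (d1.comp (1 : G) (mdifferentiable_mul_left (n := n) (φ.symm x) 1).hasMFDerivAt)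
  have d3 : HasFDerivAt (fun y => chartMul n G (x, y)) _ (chartOne n G) :=
    HasFDerivAt.comp (g := chartMul n G) (f := fun y => (x, y)) (chartOne n G) hd.hasFDerivAt
      ((hasFDerivAt_const x (chartOne n G)).prodMk (hasFDerivAt_id _))
  exact DFunLike.congr_fun (d2.unique d3) v

/-- This is L_g = R_g ∘ conj_g, differentiated at 1 and read in the chart: the relation `hcomm` that
`differential_eq_lieBracket` requires. -/
lemma chartMul_adjoint {x : EuclideanSpace ℝ (Fin n)}
    (hx : x ∈ (extChartAt (𝓡 n) (1 : G)).target)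
    (hd : DifferentiableAt ℝ (chartMul n G) (x, chartOne n G))
    (hd' : DifferentiableAt ℝ (chartMul n G) (chartOne n G, x)) (v : EuclideanSpace ℝ (Fin n)) :
    fderiv ℝ (chartMul n G) (x, chartOne n G) (0, v) =
      fderiv ℝ (chartMul n G) (chartOne n G, x)
        (AdCLM n G ((extChartAt (𝓡 n) (1 : G)).symm x) v, 0) := by
  set φ := extChartAt (𝓡 n) (1 : G) with hφ
  have hs : φ.symm x ∈ φ.source := φ.map_target hx
  have hφs : MDifferentiableAt (𝓡 n) 𝓘(ℝ, EuclideanSpace ℝ (Fin n)) φ (φ.symm x) :=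
    mdifferentiableAt_extChartAt (by rwa [← extChartAt_source (𝓡 n)])
  have d0 : MDifferentiable (𝓡 n) (𝓡 n) fun y : G => y * φ.symm x :=
    (contMDiff_mul_right (I := 𝓡 n) (n := ∞) (a := φ.symm x)).mdifferentiable (by simp)
  have d1 : MDifferentiableAt (𝓡 n) 𝓘(ℝ, EuclideanSpace ℝ (Fin n)) φ (1 * φ.symm x) := by
    rwa [one_mul]
  obtain ⟨L, d2⟩ : ∃ L : EuclideanSpace ℝ (Fin n) →L[ℝ] EuclideanSpace ℝ (Fin n),
      HasMFDerivAt (𝓡 n) 𝓘(ℝ, EuclideanSpace ℝ (Fin n)) (φ ∘ fun y => y * φ.symm x) 1 L :=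
    ⟨_, d1.hasMFDerivAt.comp (1 : G) (d0 1).hasMFDerivAt⟩
  have d3 := hasFDerivAt_of_mdifferentiableAt d2
  have d4 : HasFDerivAt (fun y => chartMul n G (y, x)) _ (chartOne n G) :=
    HasFDerivAt.comp (g := chartMul n G) (f := fun y => (y, x)) (chartOne n G) hd'.hasFDerivAt
      ((hasFDerivAt_id (chartOne n G)).prodMk (hasFDerivAt_const x _))
  have e1 := d3.unique d4
  have d5 : HasMFDerivAt (𝓡 n) 𝓘(ℝ, EuclideanSpace ℝ (Fin n)) (φ ∘ fun y => y * φ.symm x)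
      (φ.symm x * 1 * (φ.symm x)⁻¹) L := by
    rw [mul_one, mul_inv_cancel]
    exact d2
  have d6 := d5.comp (1 : G) (mdifferentiable_conj (n := n) (φ.symm x) 1).hasMFDerivAt
  have d7 : MDifferentiableAt (𝓡 n) 𝓘(ℝ, EuclideanSpace ℝ (Fin n)) φ (φ.symm x * 1) := by
    rwa [mul_one]
  have d8 := d7.hasMFDerivAt.comp (1 : G)
    (mdifferentiable_mul_left (n := n) (φ.symm x) 1).hasMFDerivAt
  have e2 : (φ ∘ fun y => y * φ.symm x) ∘ (MulAut.conj (φ.symm x)).toMonoidHom =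
      φ ∘ fun y => φ.symm x * y := by
    funext y
    simp
  rw [e2] at d6
  have e3 := hasMFDerivAt_unique d8 d6
  have d9 := hasFDerivAt_of_mdifferentiableAt d8
  have d10 : HasFDerivAt (fun y => chartMul n G (x, y)) _ (chartOne n G) :=
    HasFDerivAt.comp (g := chartMul n G) (f := fun y => (x, y)) (chartOne n G) hd.hasFDerivAt
      ((hasFDerivAt_const x (chartOne n G)).prodMk (hasFDerivAt_id _))
  have e4 := d10.unique d9
  rw [e3] at e4
  refine (DFunLike.congr_fun e4 v).trans ?_
  exact DFunLike.congr_fun e1 (AdCLM n G (φ.symm x) v)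

/-- The differential of the adjoint representation is the adjoint representation of the Lie
algebra. -/
lemma differential_AdCLM {D : EuclideanSpace ℝ (Fin n) →L[ℝ]
      EuclideanSpace ℝ (Fin n) →L[ℝ] EuclideanSpace ℝ (Fin n)}
    (hD : HasMFDerivAt (𝓡 n) 𝓘(ℝ, EuclideanSpace ℝ (Fin n) →L[ℝ] EuclideanSpace ℝ (Fin n))
      (AdCLM n G) 1 D) (u v : Lie n G) : D u v = ⁅u, v⁆ := by
  set φ := extChartAt (𝓡 n) (1 : G) with hφ
  have hA := hasFDerivAt_of_mdifferentiableAt hD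
  have ht := eventually_mem_target (n := n) (G := G)
  have hd1 := eventually_differentiableAt_chartMul (n := n) (G := G)
    (c := fun x => (x, chartOne n G)) (by fun_prop) rfl
  have hd2 := eventually_differentiableAt_chartMul (n := n) (G := G)
    (c := fun x => (chartOne n G, x)) (by fun_prop) rfl
  have key := differential_eq_lieBracket (contDiffAt_chartMul (n := n) (G := G)) ?_ ?_ hA ?_ ?_ u v
  · refine Eq.trans key.symm ?_
    -- The bracket on G is the bracket of the fields pulled back to the chart. Near the coordinates
    -- of 1 these are partial derivatives of the chart multiplication.
    have hfield : ∀ w : Lie n G,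
        (VectorField.mpullbackWithin 𝓘(ℝ, EuclideanSpace ℝ (Fin n)) (𝓡 n) φ.symm
          (mulInvariantVectorField w) (Set.range (𝓡 n))
            : EuclideanSpace ℝ (Fin n) → EuclideanSpace ℝ (Fin n)) =ᶠ[𝓝 (chartOne n G)]
          fun x => fderiv ℝ (chartMul n G) (x, chartOne n G) (0, w) := by
      intro w
      filter_upwards [ht, hd1] with x hx hx1
      rw [← mulInvariantVectorField_chart hx hx1 w, VectorField.mpullbackWithin_apply]
      congr 1
      exact ContinuousLinearMap.inverse_eq
        (mfderivWithin_extChartAt_symm_comp_mfderiv_extChartAt hx)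
        (mfderiv_extChartAt_comp_mfderivWithin_extChartAt_symm hx)
    rw [GroupLieAlgebra.bracket_def, ← VectorField.mlieBracketWithin_univ,
      VectorField.mlieBracketWithin_apply, mfderiv_extChartAt_self]
    have hset : (φ.symm ⁻¹' Set.univ ∩ Set.range (𝓡 n)) = Set.univ := by
      rw [Set.preimage_univ, Set.univ_inter, ModelWithCorners.Boundaryless.range_eq_univ]
    have hwithin : ∀ (X Y : EuclideanSpace ℝ (Fin n) → EuclideanSpace ℝ (Fin n))
        (s : Set (EuclideanSpace ℝ (Fin n))), s = Set.univ →
        VectorField.lieBracket ℝ X Y (chartOne n G) =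
          VectorField.lieBracketWithin ℝ X Y s (chartOne n G) := by
      rintro X Y _ rfl
      rw [VectorField.lieBracketWithin_univ]
    have h1 := Filter.EventuallyEq.lieBracket_vectorField_eq (𝕜 := ℝ) (hfield u) (hfield v)
    refine h1.symm.trans ?_
    refine (hwithin _ _ _ hset).trans ?_
    have hid : ∀ w : TangentSpace (𝓡 n) (1 : G),
        (ContinuousLinearMap.id ℝ (TangentSpace (𝓡 n) (1 : G))).inverse w = w := fun w => by
      rw [ContinuousLinearMap.inverse_id]
      rfl
    exact (hid _).symm
  · filter_upwards [ht] with x hx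
    change φ (φ.symm x * φ.symm (chartOne n G)) = x
    rw [chart_symm_one, mul_one, φ.right_inv hx]
  · filter_upwards [ht] with x hx
    change φ (φ.symm (chartOne n G) * φ.symm x) = x
    rw [chart_symm_one, one_mul, φ.right_inv hx]
  · change AdCLM n G (φ.symm (chartOne n G)) = 1
    rw [chart_symm_one, map_one]
  · filter_upwards [ht, hd1, hd2] with x hx h1 h2 v
    exact chartMul_adjoint hx h1 h2 v

end AdjointBracket

/-! ### One-parameter curves and the nilradical -/

section Curves

open Filter Topology

variable {n : ℕ} {G : Type*} [TopologicalSpace G] [ChartedSpace (EuclideanSpace ℝ (Fin n)) G]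
  [Group G] [LieGroup (𝓡 n) ∞ G]

/-- `γ` is, on the interval `(-ε, ε)`, an integral curve through `1` of the left invariant vector
field defined by `X`. -/
structure IsLocalOneParam (γ : ℝ → G) (X : Lie n G) (ε : ℝ) : Prop where
  pos : 0 < ε
  zero : γ 0 = 1
  hasMFDerivAt : ∀ t ∈ Metric.ball (0 : ℝ) ε, HasMFDerivAt 𝓘(ℝ, ℝ) (𝓡 n) γ t
    (ContinuousLinearMap.smulRight (1 : ℝ →L[ℝ] ℝ) (mulInvariantVectorField X (γ t)))

/-- Local existence for differential equations. A short interval is enough, since such curves serve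
only to compute a differential at 1. -/
lemma exists_isLocalOneParam (X : Lie n G) : ∃ (γ : ℝ → G) (ε : ℝ), IsLocalOneParam γ X ε := by
  have : IsManifold (𝓡 n) 1 G := IsManifold.of_le (n := ∞) (by simp)
  have hX : ContMDiffAt (𝓡 n) (𝓡 n).tangent 1
      (fun g : G => (⟨g, mulInvariantVectorField X g⟩ : TangentBundle (𝓡 n) G)) 1 :=
    (contMDiffAt_mulInvariantVectorField X).of_le
      (by rw [minSmoothness_of_isRCLikeNormedField]; exact one_le_two)
  obtain ⟨γ, h0, hγ⟩ := exists_isMIntegralCurveAt_of_contMDiffAt_boundaryless (0 : ℝ) hX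
  obtain ⟨ε, hε, h⟩ := Metric.eventually_nhds_iff_ball.1 hγ
  exact ⟨γ, ε, hε, h0, h⟩

variable {A : Type*} [NormedRing A] [NormedAlgebra ℝ A]

/-- By multiplicativity of R, the curve R ∘ γ solves the linear equation y' = y · D X. -/
lemma IsLocalOneParam.hasDerivAt {γ : ℝ → G} {X : Lie n G} {ε : ℝ} (hγ : IsLocalOneParam γ X ε)
    {R : G →* A} {D : EuclideanSpace ℝ (Fin n) →L[ℝ] A}
    (hD : HasMFDerivAt (𝓡 n) 𝓘(ℝ, A) R 1 D) (hR : MDifferentiable (𝓡 n) 𝓘(ℝ, A) R)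
    {t : ℝ} (ht : t ∈ Metric.ball (0 : ℝ) ε) :
    HasDerivAt (fun s => R (γ s)) (R (γ t) * D X) t := by
  have h1 := (hR (γ t)).hasMFDerivAt.comp t (hγ.hasMFDerivAt t ht)
  have h2 := h1.hasFDerivAt
  have h3 : HasFDerivAt (fun s => R (γ s))
      (ContinuousLinearMap.smulRight (1 : ℝ →L[ℝ] ℝ) (R (γ t) * D X)) t := by
    have h4 : ContinuousLinearMap.smulRight (1 : ℝ →L[ℝ] ℝ) (R (γ t) * D X) =
        (show EuclideanSpace ℝ (Fin n) →L[ℝ] A from mfderiv (𝓡 n) 𝓘(ℝ, A) R (γ t)).comp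
          (ContinuousLinearMap.smulRight (1 : ℝ →L[ℝ] ℝ)
            (show EuclideanSpace ℝ (Fin n) from mulInvariantVectorField X (γ t))) := by
      have h5 : ∀ (P : EuclideanSpace ℝ (Fin n) →L[ℝ] A) (y : EuclideanSpace ℝ (Fin n)),
          ContinuousLinearMap.smulRight (1 : ℝ →L[ℝ] ℝ) (P y) =
            P.comp (ContinuousLinearMap.smulRight (1 : ℝ →L[ℝ] ℝ) y) := fun P y => by
        ext
        simp
      exact (congrArg _ (mfderiv_hom_mul hD hR (γ t) X).symm).trans (h5 _ _)
    rw [h4]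
    exact h2
  simpa using h3.hasDerivAt

/-- The product R(γ s) exp(-s D X) has zero derivative, hence keeps its value 1 at s = 0. -/
lemma IsLocalOneParam.eq_exp [CompleteSpace A] {γ : ℝ → G} {X : Lie n G} {ε : ℝ}
    (hγ : IsLocalOneParam γ X ε)
    {R : G →* A} {D : EuclideanSpace ℝ (Fin n) →L[ℝ] A}
    (hD : HasMFDerivAt (𝓡 n) 𝓘(ℝ, A) R 1 D) (hR : MDifferentiable (𝓡 n) 𝓘(ℝ, A) R)
    {t : ℝ} (ht : t ∈ Metric.ball (0 : ℝ) ε) : R (γ t) = NormedSpace.exp (t • D X) := by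
  have hd : ∀ s ∈ Metric.ball (0 : ℝ) ε,
      HasDerivAt (fun s => R (γ s) * NormedSpace.exp (s • (-D X))) 0 s := fun s hs => by
    have := (hγ.hasDerivAt hD hR hs).mul (hasDerivAt_exp_smul_const' (𝕂 := ℝ) (-D X) s)
    rwa [neg_mul, mul_neg, ← mul_assoc, add_neg_cancel] at this
  have hc := (convex_ball (0 : ℝ) ε).is_const_of_fderivWithin_eq_zero (𝕜 := ℝ)
    (f := fun s => R (γ s) * NormedSpace.exp (s • (-D X)))
    (fun s hs => (hd s hs).differentiableAt.differentiableWithinAt)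
    (fun s hs => by
      rw [fderivWithin_of_isOpen Metric.isOpen_ball hs, (hd s hs).hasFDerivAt.fderiv]
      ext
      simp)
    ht (Metric.mem_ball_self hγ.pos)
  have hexp : NormedSpace.exp (t • (-D X)) * NormedSpace.exp (t • D X) = 1 := by
    let _ : NormedAlgebra ℚ A := NormedAlgebra.restrictScalars ℚ ℝ A
    rw [smul_neg, ← NormedSpace.exp_add_of_commute ((Commute.refl (t • D X)).neg_left),
      neg_add_cancel, NormedSpace.exp_zero]
  simp only [hγ.zero, map_one, zero_smul, NormedSpace.exp_zero, mul_one] at hc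
  have := congrArg (· * NormedSpace.exp (t • D X)) hc
  beta_reduce at this
  rwa [mul_assoc, hexp, mul_one, one_mul] at this

/-- All terms of the exponential series after the first lie in g (k + 1), a closed subspace. -/
lemma exp_sub_mem {E : Type*} [NormedAddCommGroup E] [NormedSpace ℝ E] [FiniteDimensional ℝ E]
    {g : ℕ → Submodule ℝ E} (hg : Antitone g) {Z : E →L[ℝ] E}
    (hZ : ∀ k, ∀ w ∈ g k, Z w ∈ g (k + 1)) (k : ℕ) {w : E} (hw : w ∈ g k) :
    NormedSpace.exp Z w - w ∈ g (k + 1) := by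
  have : CompleteSpace E := FiniteDimensional.complete ℝ E
  have h1 := NormedSpace.exp_series_hasSum_exp' (𝕂 := ℝ) Z
  have h2 := (ContinuousLinearMap.apply ℝ E w).hasSum h1
  have h3 := (hasSum_nat_add_iff' 1).2 h2
  have hpow : ∀ m, (Z ^ m) w ∈ g k := by
    intro m
    induction m with
    | zero => simpa using hw
    | succ m ih =>
      rw [pow_succ', mul_apply_eq_comp]
      exact hg k.le_succ (hZ k _ ih)
  have h4 := (Submodule.closed_of_finiteDimensional (g (k + 1))).mem_of_tendsto
    h3.tendsto_sum_nat (Eventually.of_forall fun N => Submodule.sum_mem _ fun m _ => by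
      simp only [map_smul, ContinuousLinearMap.apply_apply]
      refine Submodule.smul_mem _ _ ?_
      rw [pow_succ', mul_apply_eq_comp]
      exact hZ k _ (hpow m))
  simpa using h4

/-- The Lie algebra automorphism induced by a smooth automorphism of a Lie group. -/
noncomputable def lieEquivOfAut (f g : G →* G) (hf : ContMDiff (𝓡 n) (𝓡 n) ∞ f)
    (hg : ContMDiff (𝓡 n) (𝓡 n) ∞ g) (hfg : ∀ x, f (g x) = x) (hgf : ∀ x, g (f x) = x) :
    Lie n G ≃ₗ⁅ℝ⁆ Lie n G :=
  { lieMap (n := n) f with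
    map_lie' := lieMap_lie hf hg hfg hgf _ _
    invFun := lieMap (n := n) g
    left_inv := fun v => by
      have h := lieMap_comp (n := n) g f (hg.mdifferentiable (by simp))
        (hf.mdifferentiable (by simp))
      rw [show g.comp f = MonoidHom.id G from MonoidHom.ext hgf, lieMap_id] at h
      exact (LinearMap.congr_fun h v).symm
    right_inv := fun v => by
      have h := lieMap_comp (n := n) f g (hf.mdifferentiable (by simp))
        (hg.mdifferentiable (by simp))
      rw [show f.comp g = MonoidHom.id G from MonoidHom.ext hfg, lieMap_id] at h
      exact (LinearMap.congr_fun h v).symm }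

lemma contMDiff_conj (g : G) : ContMDiff (𝓡 n) (𝓡 n) ∞ (MulAut.conj g).toMonoidHom :=
  ((contMDiff_const.mul contMDiff_id).mul contMDiff_const :
    ContMDiff (𝓡 n) (𝓡 n) ∞ (fun x : G => g * x * g⁻¹))

lemma Ad_mem_lcs_nilradical (a : G) (k : ℕ) {w : Lie n G}
    (hw : w ∈ (nilradical (Lie n G)).lcs _ k) :
    (Ad n G a : Module.End ℝ (Lie n G)) w ∈ (nilradical (Lie n G)).lcs (Lie n G) k :=
  lcs_nilradical_invariant (lieEquivOfAut (MulAut.conj a).toMonoidHom (MulAut.conj a⁻¹).toMonoidHom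
    (contMDiff_conj a) (contMDiff_conj a⁻¹) (fun x => by simp [mul_assoc])
    (fun x => by simp [mul_assoc])) k hw

/-- One-parameter curves tangent to the nilradical are mapped by `Ad` to the unipotent radical. -/
lemma IsLocalOneParam.Ad_mem_unipotentRadical {γ : ℝ → G} {X : Lie n G} {ε : ℝ}
    (hγ : IsLocalOneParam γ X ε) (hX : X ∈ nilradical (Lie n G)) {U : Subgroup (GLin (Lie n G))}
    (hU : IsUnipotentRadical (zariskiClosure (Ad n G).range) U) {t : ℝ}
    (ht : t ∈ Metric.ball (0 : ℝ) ε) : Ad n G (γ t) ∈ U := by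
  -- This filtration runs from the whole Lie algebra down to 0. It is invariant under Ad, hence
  -- under the Zariski closure, and ad X shifts it by one step when X is in the nilradical.
  let g : ℕ → Submodule ℝ (Lie n G) := fun k => ((nilradical (Lie n G)).lcs (Lie n G) k).toSubmodule
  have hg : Antitone g := fun i j h => lcs_antitone _ h
  obtain ⟨K, hK⟩ := exists_lcs_nilradical_eq_bot (L := Lie n G)
  have hA : ∀ a ∈ zariskiClosure (Ad n G).range, ∀ k, ∀ w ∈ g k,
      (a : Module.End ℝ (Lie n G)) w ∈ g k := fun a ha k w hw =>
    zariskiClosure_preserves (g k) (by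
      rintro _ ⟨b, rfl⟩ v hv
      exact Ad_mem_lcs_nilradical b k hv) ha hw
  refine filtrationUnipotent_inf_le hU hg (by simp [g]) (K := K) (by simp [g, hK]) hA
    ⟨fun k w hw => ?_, le_zariskiClosure _ ⟨γ t, rfl⟩⟩
  have hR := (contMDiff_AdCLM (n := n) (G := G)).mdifferentiable (by simp)
  obtain ⟨D, hD⟩ : ∃ D : EuclideanSpace ℝ (Fin n) →L[ℝ]
      EuclideanSpace ℝ (Fin n) →L[ℝ] EuclideanSpace ℝ (Fin n),
      HasMFDerivAt (𝓡 n) 𝓘(ℝ, EuclideanSpace ℝ (Fin n) →L[ℝ] EuclideanSpace ℝ (Fin n))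
        (AdCLM n G) 1 D := ⟨_, (hR 1).hasMFDerivAt⟩
  have h1 := hγ.eq_exp hD hR ht
  have h2 := exp_sub_mem (E := EuclideanSpace ℝ (Fin n)) (g := g) hg (Z := t • D X)
    (fun k v hv => (g (k + 1)).smul_mem t (by
      have h3 : (⁅X, v⁆ : Lie n G) ∈ g (k + 1) := by
        change (⁅X, v⁆ : Lie n G) ∈ (nilradical (Lie n G)).lcs (Lie n G) (k + 1)
        rw [LieIdeal.lcs_succ]
        exact LieSubmodule.lie_mem_lie hX hv
      exact (congrArg (· ∈ g (k + 1)) (differential_AdCLM hD X v)).mpr h3)) k hw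
  rw [← h1] at h2
  exact h2

end Curves

/-! ### The torus and the action -/

section Torus

variable {n : ℕ} {G : Type*} [TopologicalSpace G] [ChartedSpace (EuclideanSpace ℝ (Fin n)) G]
  [Group G]

/-- A representation on the Lie algebra, with values in the Banach algebra of endomorphisms. -/
noncomputable def repCLM (ρ : G →* GLin (Lie n G)) :
    G →* (EuclideanSpace ℝ (Fin n) →L[ℝ] EuclideanSpace ℝ (Fin n)) where
  toFun a := LinearMap.toContinuousLinearMap (E := EuclideanSpace ℝ (Fin n))
    (show Module.End ℝ (EuclideanSpace ℝ (Fin n)) from (ρ a : Module.End ℝ (Lie n G)))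
  map_one' := by
    ext v : 1
    exact LinearMap.congr_fun (congrArg Units.val (map_one ρ)) v
  map_mul' g h := by
    ext v : 1
    exact LinearMap.congr_fun (congrArg Units.val (map_mul ρ g h)) v

lemma contMDiff_clm_of_apply {M : Type*} [TopologicalSpace M]
    [ChartedSpace (EuclideanSpace ℝ (Fin n)) M]
    {f : M → EuclideanSpace ℝ (Fin n) →L[ℝ] EuclideanSpace ℝ (Fin n)}
    (hf : ∀ v, ContMDiff (𝓡 n) 𝓘(ℝ, EuclideanSpace ℝ (Fin n)) ∞ fun x => f x v) :
    ContMDiff (𝓡 n) 𝓘(ℝ, EuclideanSpace ℝ (Fin n) →L[ℝ] EuclideanSpace ℝ (Fin n)) ∞ f := by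
  let b := EuclideanSpace.basisFun (Fin n) ℝ
  let P : Fin n → EuclideanSpace ℝ (Fin n) →L[ℝ]
      EuclideanSpace ℝ (Fin n) →L[ℝ] EuclideanSpace ℝ (Fin n) := fun i =>
    ContinuousLinearMap.smulRightL ℝ _ _ (EuclideanSpace.proj i)
  have h : f = fun x => ∑ i, P i (f x (b i)) := by
    funext x
    refine ContinuousLinearMap.coe_injective (b.toBasis.ext fun j => ?_)
    simp [P, b, ite_smul]
  rw [h]
  exact ContMDiff.sum fun i _ => (P i).contMDiff.comp (hf (b i))

variable [LieGroup (𝓡 n) ∞ G] {V : Submodule ℝ (Lie n G)}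

lemma isSemisimple_ads (hV : IsAdmissibleComplement V) (x : Lie n G) :
    (ads hV x).IsSemisimple := by
  obtain ⟨-, -, -, h, -, -⟩ := semisimplePart_spec
    (LieAlgebra.ad ℝ (Lie n G) (V.projectionOnto _ hV.isCompl x : Lie n G))
  exact h

lemma ads_apply_eq_zero (hV : IsAdmissibleComplement V) (x : Lie n G) {v : Lie n G} (hv : v ∈ V) :
    ads hV x v = 0 :=
  hV.semisimplePart_ad _ (Submodule.coe_mem _) _ hv

lemma commute_ads (hV : IsAdmissibleComplement V) (x y : Lie n G) :
    Commute (ads hV x) (ads hV y) :=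
  commute_semisimplePart_ad (hV.semisimplePart_ad _ (Submodule.coe_mem _) _ (Submodule.coe_mem _))

/-- The algebra generated by the endomorphisms `ad_s x`. -/
noncomputable def adsAlgebra (hV : IsAdmissibleComplement V) :
    Subalgebra ℝ (Module.End ℝ (Lie n G)) :=
  Algebra.adjoin ℝ (Set.range (ads hV))

lemma isSemisimple_of_mem_adsAlgebra (hV : IsAdmissibleComplement V) {f : Module.End ℝ (Lie n G)}
    (hf : f ∈ adsAlgebra hV) : f.IsSemisimple :=
  isSemisimple_of_mem_adjoin (by rintro _ ⟨x, rfl⟩; exact isSemisimple_ads hV x)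
    (by rintro _ ⟨x, rfl⟩ _ ⟨y, rfl⟩; exact commute_ads hV x y) hf

lemma commute_of_mem_adsAlgebra (hV : IsAdmissibleComplement V) {f g : Module.End ℝ (Lie n G)}
    (hf : f ∈ adsAlgebra hV) (hg : g ∈ adsAlgebra hV) : Commute f g := by
  have hc : ∀ a ∈ Set.range (ads hV), ∀ b ∈ Set.range (ads hV), Commute a b := by
    rintro _ ⟨x, rfl⟩ _ ⟨y, rfl⟩
    exact commute_ads hV x y
  exact Algebra.commute_of_mem_adjoin_of_forall_mem_commute hg fun b hb =>
    (Algebra.commute_of_mem_adjoin_of_forall_mem_commute hf fun c hc' => hc b hb c hc').symm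

lemma IntegratesAds.contMDiff {hV : IsAdmissibleComplement V} {ρ : G →* GLin (Lie n G)}
    (hρ : IntegratesAds hV ρ) : ContMDiff (𝓡 n)
      𝓘(ℝ, EuclideanSpace ℝ (Fin n) →L[ℝ] EuclideanSpace ℝ (Fin n)) ∞ (repCLM ρ) :=
  contMDiff_clm_of_apply fun v => (hρ v).1

lemma IntegratesAds.exists_hasMFDerivAt {hV : IsAdmissibleComplement V}
    {ρ : G →* GLin (Lie n G)} (hρ : IntegratesAds hV ρ) :
    ∃ D : EuclideanSpace ℝ (Fin n) →L[ℝ] EuclideanSpace ℝ (Fin n) →L[ℝ] EuclideanSpace ℝ (Fin n),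
      HasMFDerivAt (𝓡 n) 𝓘(ℝ, EuclideanSpace ℝ (Fin n) →L[ℝ] EuclideanSpace ℝ (Fin n))
        (repCLM ρ) 1 D ∧ ∀ x v : Lie n G, D x v = ads hV x v := by
  have hR := hρ.contMDiff.mdifferentiable (by simp) 1
  refine ⟨_, hR.hasMFDerivAt, fun x v => ?_⟩
  have h1 : ∀ v : EuclideanSpace ℝ (Fin n),
      HasMFDerivAt 𝓘(ℝ, EuclideanSpace ℝ (Fin n) →L[ℝ] EuclideanSpace ℝ (Fin n))
        𝓘(ℝ, EuclideanSpace ℝ (Fin n)) (fun L : EuclideanSpace ℝ (Fin n) →L[ℝ]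
          EuclideanSpace ℝ (Fin n) => L v) (repCLM ρ 1)
        (ContinuousLinearMap.apply ℝ (EuclideanSpace ℝ (Fin n)) v) := fun v =>
    (ContinuousLinearMap.apply ℝ (EuclideanSpace ℝ (Fin n)) v).hasMFDerivAt
  have h2 := ((h1 v).comp (1 : G) hR.hasMFDerivAt).mfderiv
  exact (congrArg (fun L : EuclideanSpace ℝ (Fin n) →L[ℝ] EuclideanSpace ℝ (Fin n) => L x)
    h2).symm.trans ((hρ v).2 x)

variable [PreconnectedSpace G]

/-- Whatever commutes with all ad_s x intertwines the differential of Ad_s with itself, so it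
commutes with Ad_s(a). The double centralizer lemma concludes. -/
lemma Ads_mem_adsAlgebra (hV : IsAdmissibleComplement V) (a : G) :
    (Ads hV a : Module.End ℝ (Lie n G)) ∈ adsAlgebra hV := by
  unfold Ads
  split_ifs with h
  · have hρ := h.choose_spec
    obtain ⟨D, hD, hD'⟩ := hρ.exists_hasMFDerivAt
    have hR := hρ.contMDiff.mdifferentiable (by simp)
    refine mem_adjoin_of_centralizer (by rintro _ ⟨x, rfl⟩; exact isSemisimple_ads hV x)
      (by rintro _ ⟨x, rfl⟩ _ ⟨y, rfl⟩; exact commute_ads hV x y) fun c hc => ?_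
    let c' := LinearMap.toContinuousLinearMap (E := EuclideanSpace ℝ (Fin n))
      (show Module.End ℝ (EuclideanSpace ℝ (Fin n)) from c)
    have h1 := intertwines_of_differential hR hR hD hD (c := c') (fun x => by
      ext v : 1
      exact (hD' x (c v)).trans ((LinearMap.congr_fun (hc _ ⟨x, rfl⟩).eq v).symm.trans
        (congrArg c (hD' x v)).symm)) a
    refine LinearMap.ext fun v => ?_
    exact (congrArg
      (fun L : EuclideanSpace ℝ (Fin n) →L[ℝ] EuclideanSpace ℝ (Fin n) => L v) h1).symm
  · exact one_mem _

/-- This is what makes T commutative and its elements semisimple. -/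
lemma mem_adsAlgebra_of_mem_maxTorus (hV : IsAdmissibleComplement V) {t : GLin (Lie n G)}
    (ht : t ∈ maxTorus hV) : (t : Module.End ℝ (Lie n G)) ∈ adsAlgebra hV :=
  zariskiClosure_submodule (Subalgebra.toSubmodule (adsAlgebra hV))
    (by rintro _ ⟨a, rfl⟩; exact Ads_mem_adsAlgebra hV a) ht

/-- The orbit map of v is equivariant, and its differential x ↦ ad_s(x) v vanishes at 1 because ad_s
kills V. -/
lemma Ads_apply_eq_self (hV : IsAdmissibleComplement V) (a : G) {v : Lie n G} (hv : v ∈ V) :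
    (Ads hV a : Module.End ℝ (Lie n G)) v = v := by
  unfold Ads
  split_ifs with h
  · have hρ := h.choose_spec
    have h1 := eq_of_mfderiv_one_eq_zero (n := n) (G := G) (I' := 𝓘(ℝ, EuclideanSpace ℝ (Fin n)))
      (f := fun a : G => (show EuclideanSpace ℝ (Fin n) from
        (h.choose a : Module.End ℝ (Lie n G)) v))
      (Λ := fun a w => repCLM h.choose a w)
      ((hρ v).1.mdifferentiable (by simp))
      (fun a => (repCLM h.choose a).contMDiff.mdifferentiable (n := 1) (by simp))
      (fun a x => LinearMap.congr_fun (congrArg Units.val (map_mul h.choose a x)) v)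
      (ContinuousLinearMap.ext fun x => ((hρ v).2 x).trans (ads_apply_eq_zero hV x hv)) a
    exact h1.trans (LinearMap.congr_fun (congrArg Units.val (map_one h.choose)) v)
  · rfl

lemma apply_eq_self_of_mem_maxTorus (hV : IsAdmissibleComplement V) {t : GLin (Lie n G)}
    (ht : t ∈ maxTorus hV) {v : Lie n G} (hv : v ∈ V) : (t : Module.End ℝ (Lie n G)) v = v :=
  zariskiClosure_linear (LinearMap.applyₗ v) v
    (by rintro _ ⟨a, rfl⟩; exact Ads_apply_eq_self hV a hv) ht

omit [PreconnectedSpace G] in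
-- Commuting with c is a linear condition. It is used with c the value of J at 1.
lemma commute_of_mem_maxTorus (hV : IsAdmissibleComplement V) {c : Module.End ℝ (Lie n G)}
    (hc : ∀ a, Commute c (Ads hV a : Module.End ℝ (Lie n G))) {t : GLin (Lie n G)}
    (ht : t ∈ maxTorus hV) : Commute c (t : Module.End ℝ (Lie n G)) := by
  have := zariskiClosure_linear (LinearMap.mulLeft ℝ c - LinearMap.mulRight ℝ c) 0
    (by rintro _ ⟨a, rfl⟩; exact sub_eq_zero.2 (hc a).eq) ht
  exact sub_eq_zero.1 this

omit [Group G] [LieGroup (𝓡 n) ∞ G] [PreconnectedSpace G] [TopologicalSpace G]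
  [ChartedSpace (EuclideanSpace ℝ (Fin n)) G] in
lemma mem_of_mem_identityComponent {W : Type*} [AddCommGroup W] [Module ℝ W]
    [FiniteDimensional ℝ W] {A : Subgroup (GLin W)} (t : identityComponent A) :
    (t : GLin W) ∈ A := by
  obtain ⟨s, -, hs⟩ := t.2
  rw [← hs]
  exact s.2

/-- The projection to the torus kills one-parameter curves tangent to the nilradical. -/
lemma IsLocalOneParam.torusPart_eq_one (hV : IsAdmissibleComplement V) {γ : ℝ → G} {X : Lie n G}
    {ε : ℝ} (hγ : IsLocalOneParam γ X ε) (hX : X ∈ nilradical (Lie n G)) {t : ℝ}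
    (ht : t ∈ Metric.ball (0 : ℝ) ε) : torusPart hV (γ t) = 1 := by
  unfold torusPart
  split_ifs with h
  · obtain ⟨U, hU, hπ⟩ := h.choose_spec
    have h1 := hγ.Ad_mem_unipotentRadical hX hU ht
    -- Both Ad γ(t) and π(γ t)⁻¹ Ad γ(t) lie in U.
    have h2 : (h.choose (γ t) : GLin (Lie n G)) ∈ U := by
      have := U.mul_mem h1 (U.inv_mem (hπ (γ t)))
      simpa [mul_assoc] using this
    -- Hence π(γ t) - 1 is nilpotent as well as an element of the semisimple algebra, so it
    -- vanishes.
    have h3 := mem_adsAlgebra_of_mem_maxTorus hV (mem_of_mem_identityComponent (h.choose (γ t)))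
    have h4 := isSemisimple_of_mem_adsAlgebra hV (sub_mem h3 (one_mem _))
    have h5 := Module.End.eq_zero_of_isNilpotent_isSemisimple (hU.1.2.2 _ h2) h4
    exact Subtype.ext (Units.ext (sub_eq_zero.1 h5))
  · rfl

end Torus

/-! ### The action through the torus -/

section Action

open Filter Topology

variable {n : ℕ} {G : Type*} [TopologicalSpace G] [ChartedSpace (EuclideanSpace ℝ (Fin n)) G]
  [Group G] [LieGroup (𝓡 n) ∞ G]

/-- A smooth action `Θ` of `G` on itself by commuting automorphisms which preserve the left
invariant structure `J` and for which `Θ` is invariant. -/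
structure IsTwisting (J : EndField n G) (Θ : G →* MulAut G) : Prop where
  contMDiff : ContMDiff ((𝓡 n).prod (𝓡 n)) (𝓡 n) ∞ (fun q : G × G => Θ q.1 q.2)
  map_apply : ∀ a b, Θ (Θ a b) = Θ b
  commute : ∀ a b, Commute (Θ a) (Θ b)
  map_J : ∀ (a : G) (v : Lie n G),
    J 1 (lieMap (n := n) (Θ a).toMonoidHom v) = lieMap (n := n) (Θ a).toMonoidHom (J 1 v)

omit [LieGroup (𝓡 n) ∞ G] in
lemma isTwisting_one (J : EndField n G) : IsTwisting J (1 : G →* MulAut G) where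
  contMDiff := contMDiff_snd
  map_apply _ _ := rfl
  commute _ _ := Commute.refl _
  map_J a v := by
    have h : lieMap (n := n) ((1 : G →* MulAut G) a).toMonoidHom = 1 := lieMap_id
    rw [h]
    rfl

section Integrates

variable {ρ : G →* GLin (Lie n G)} {Θ : G →* MulAut G}

omit [LieGroup (𝓡 n) ∞ G] in
lemma IntegratesAction.contMDiff_apply (h : IntegratesAction ρ Θ) (a : G) :
    ContMDiff (𝓡 n) (𝓡 n) ∞ (Θ a).toMonoidHom :=
  h.1.comp (contMDiff_const.prodMk contMDiff_id)

/-- Smoothness of ρ is read off the action, as ρ a is the differential of Θ a at its fixed point 1.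
For π_S this replaces a regularity statement about the chosen π. -/
lemma IntegratesAction.contMDiff_repCLM (h : IntegratesAction ρ Θ) : ContMDiff (𝓡 n)
    𝓘(ℝ, EuclideanSpace ℝ (Fin n) →L[ℝ] EuclideanSpace ℝ (Fin n)) ∞ (repCLM ρ) := by
  have h1 := contMDiff_mfderiv_family (Φ := fun a b => Θ a b) h.1 (by simp)
  convert h1 using 1
  funext a
  ext v : 1
  exact (LinearMap.congr_fun (h.2 a) v).symm

lemma IntegratesAction.mem_nilradical (h : IntegratesAction ρ Θ) (a : G) {v : Lie n G}
    (hv : v ∈ nilradical (Lie n G)) :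
    (ρ a : Module.End ℝ (Lie n G)) v ∈ nilradical (Lie n G) := by
  have h1 := nilradical_invariant (lieEquivOfAut (Θ a).toMonoidHom (Θ a⁻¹).toMonoidHom
    (h.contMDiff_apply a) (h.contMDiff_apply a⁻¹) (fun x => by simp) (fun x => by simp)) hv
  rw [← h.2 a]
  exact h1

variable [PreconnectedSpace G]

lemma IntegratesAction.eq_of_eq (h : IntegratesAction ρ Θ) {a b : G} (hab : ρ a = ρ b) :
    Θ a = Θ b := by
  have h1 := hom_eq_of_lieMap_eq (n := n) ((h.contMDiff_apply a).mdifferentiable (by simp))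
    ((h.contMDiff_apply b).mdifferentiable (by simp)) ((h.2 a).trans ((congrArg _ hab).trans
      (h.2 b).symm))
  exact MulEquiv.ext fun x => DFunLike.congr_fun h1 x

lemma IntegratesAction.commute (h : IntegratesAction ρ Θ) {a b : G} (hab : Commute (ρ a) (ρ b)) :
    Commute (Θ a) (Θ b) := by
  have : Θ (a * b) = Θ (b * a) := h.eq_of_eq (by rw [map_mul, map_mul, hab.eq])
  rwa [map_mul, map_mul] at this

end Integrates

variable [PreconnectedSpace G] {V : Submodule ℝ (Lie n G)} (hV : IsAdmissibleComplement V)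
  {S : Subgroup (GLin (Lie n G))} (hST : S ≤ maxTorus hV)
  (p : identityComponent (maxTorus hV) →* identityComponent S)

lemma IsLocalOneParam.piS_eq_one {γ : ℝ → G} {X : Lie n G}
    {ε : ℝ} (hγ : IsLocalOneParam γ X ε) (hX : X ∈ nilradical (Lie n G)) {t : ℝ}
    (ht : t ∈ Metric.ball (0 : ℝ) ε) : piS hV p (γ t) = 1 := by
  simp [piS, hγ.torusPart_eq_one hV hX ht]

include hST in
omit [PreconnectedSpace G] in
lemma piS_mem_maxTorus (a : G) : piS hV p a ∈ maxTorus hV :=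
  hST (mem_of_mem_identityComponent (p (torusPart hV a)))

variable {p}

include hST in
/-- The action through the torus part is invariant under itself. -/
lemma IntegratesAction.piS_apply {Θ : G →* MulAut G}
    (h : IntegratesAction (piS hV p) Θ) (a b : G) : piS hV p (Θ a b) = piS hV p b := by
  have hR := h.contMDiff_repCLM.mdifferentiable (by simp)
  obtain ⟨D, hD⟩ : ∃ D : EuclideanSpace ℝ (Fin n) →L[ℝ]
      EuclideanSpace ℝ (Fin n) →L[ℝ] EuclideanSpace ℝ (Fin n),
      HasMFDerivAt (𝓡 n) 𝓘(ℝ, EuclideanSpace ℝ (Fin n) →L[ℝ] EuclideanSpace ℝ (Fin n))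
        (repCLM (piS hV p)) 1 D := ⟨_, (hR 1).hasMFDerivAt⟩
  -- Along an integral curve of X, π_S is constant, and its derivative at 0 is D X.
  have h0 : ∀ X ∈ nilradical (Lie n G), D X = 0 := by
    intro X hX
    obtain ⟨γ, ε, hγ⟩ := exists_isLocalOneParam X
    have h1 := hγ.hasDerivAt hD hR (Metric.mem_ball_self hγ.pos)
    rw [hγ.zero, map_one, one_mul] at h1
    refine h1.unique ((hasDerivAt_const (0 : ℝ) (1 : EuclideanSpace ℝ (Fin n) →L[ℝ]
      EuclideanSpace ℝ (Fin n))).congr_of_eventuallyEq ?_)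
    filter_upwards [Metric.ball_mem_nhds (0 : ℝ) hγ.pos] with t ht
    ext v : 1
    exact LinearMap.congr_fun (congrArg Units.val (hγ.piS_eq_one hV p hX ht)) v
  -- Split v along V and the nilradical: π_S(a) fixes the first component, and moves the second
  -- inside the nilradical, where D vanishes.
  have h1 : ∀ v : Lie n G, D ((piS hV p a : Module.End ℝ (Lie n G)) v) = D v := by
    intro v
    obtain ⟨y, hy, z, hz, rfl⟩ := Submodule.mem_sup.1
      (hV.isCompl.sup_eq_top ▸ Submodule.mem_top (x := v) :)
    rw [map_add, apply_eq_self_of_mem_maxTorus hV (piS_mem_maxTorus hV hST p a) hy]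
    have e1 := D.map_add y ((piS hV p a : Module.End ℝ (Lie n G)) z)
    have e2 := D.map_add y z
    rw [h0 z hz] at e2
    rw [h0 _ (h.mem_nilradical a hz)] at e1
    exact e1.trans e2.symm
  have hΘ : MDifferentiable (𝓡 n) (𝓡 n) (Θ a).toMonoidHom :=
    (h.contMDiff_apply a).mdifferentiable (by simp)
  have hD' : HasMFDerivAt (𝓡 n) 𝓘(ℝ, EuclideanSpace ℝ (Fin n) →L[ℝ] EuclideanSpace ℝ (Fin n))
      ((repCLM (piS hV p)).comp (Θ a).toMonoidHom) 1
      (D.comp (show EuclideanSpace ℝ (Fin n) →L[ℝ] EuclideanSpace ℝ (Fin n) from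
        mfderiv (𝓡 n) (𝓡 n) (Θ a).toMonoidHom 1)) := by
    have h2 : HasMFDerivAt (𝓡 n) 𝓘(ℝ, EuclideanSpace ℝ (Fin n) →L[ℝ] EuclideanSpace ℝ (Fin n))
        (repCLM (piS hV p)) ((Θ a).toMonoidHom 1) D := by rwa [map_one]
    exact h2.comp (1 : G) (hΘ 1).hasMFDerivAt
  -- The representations π_S ∘ Θ_a and π_S have the same differential; the intertwiner 1 shows that
  -- they coincide.
  have h3 := intertwines_of_differential
    (R₁ := (repCLM (piS hV p)).comp (Θ a).toMonoidHom) (hR.comp hΘ) hR hD' hD (c := 1) (fun v => by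
    rw [mul_one, one_mul]
    exact (congrArg D (LinearMap.congr_fun (h.2 a) v)).trans (h1 v)) b
  rw [mul_one, one_mul] at h3
  refine Units.ext (LinearMap.ext fun v => ?_)
  exact congrArg (fun L : EuclideanSpace ℝ (Fin n) →L[ℝ] EuclideanSpace ℝ (Fin n) => L v) h3

include hST in
-- Each property of Θ is that of π_S, lifted to G because automorphisms of a connected group are
-- determined by their differential. If no action integrates π_S, the default action is trivial and
-- the properties are immediate.
lemma isTwisting_action {J : EndField n G} (hcomm : ∀ (g : G) (v : Lie n G),
      J 1 ((Ads hV g : Module.End ℝ (Lie n G)) v)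
        = (Ads hV g : Module.End ℝ (Lie n G)) (J 1 v)) :
    IsTwisting J (action (piS hV p)) := by
  unfold action
  split_ifs with h
  · have hΘ := h.choose_spec
    refine ⟨hΘ.1, fun a b => hΘ.eq_of_eq (hΘ.piS_apply hV hST a b), fun a b => hΘ.commute ?_,
      fun a v => ?_⟩
    · exact Units.ext (commute_of_mem_adsAlgebra hV
        (mem_adsAlgebra_of_mem_maxTorus hV (piS_mem_maxTorus hV hST p a))
        (mem_adsAlgebra_of_mem_maxTorus hV (piS_mem_maxTorus hV hST p b))).eq
    · rw [hΘ.2 a]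
      have h1 := commute_of_mem_maxTorus hV (c := (J 1).toLinearMap)
        (fun g => LinearMap.ext (hcomm g)) (piS_mem_maxTorus hV hST p a)
      exact LinearMap.congr_fun h1.eq v
  · exact isTwisting_one J

lemma action_eq_one {a : G} (ha : piS hV p a = 1) : action (piS hV p) a = 1 := by
  unfold action
  split_ifs with h
  · rw [← map_one h.choose]
    exact h.choose_spec.eq_of_eq (by rw [ha, map_one])
  · rfl

end Action

/-! ### The twisted group structure -/

section Twist

variable {n : ℕ} {G : Type*} [TopologicalSpace G] [ChartedSpace (EuclideanSpace ℝ (Fin n)) G]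
  [Group G] [LieGroup (𝓡 n) ∞ G] {J : EndField n G}

/-- Left translations trivialize the tangent bundle, so identities between linear maps may be tested
on left invariant fields. -/
lemma exists_mulInvariantVectorField_eq (g : G) (w : TangentSpace (𝓡 n) g) :
    ∃ v : Lie n G, mulInvariantVectorField v g = w := by
  have h1 := mfderiv_comp g (mdifferentiable_mul_left (n := n) g (g⁻¹ * g))
    (mdifferentiable_mul_left (n := n) g⁻¹ g)
  have h2 : ((fun x => g * x) ∘ fun x => g⁻¹ * x) = (id : G → G) := by
    funext x
    simp
  rw [h2, mfderiv_id] at h1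
  have h3 : ∀ x, x = (1 : G) → ∀ u : EuclideanSpace ℝ (Fin n),
      (show EuclideanSpace ℝ (Fin n) from mfderiv (𝓡 n) (𝓡 n) (fun x => g * x) x u) =
        mfderiv (𝓡 n) (𝓡 n) (fun x => g * x) 1 u := by
    rintro x rfl u
    rfl
  exact ⟨mfderiv (𝓡 n) (𝓡 n) (fun x => g⁻¹ * x) g w, (h3 _ (inv_mul_cancel g) _).symm.trans
    (congrArg (fun L : EuclideanSpace ℝ (Fin n) →L[ℝ] EuclideanSpace ℝ (Fin n) => L w) h1).symm⟩

lemma IsLeftInvariantComplexStructure.apply_mulInvariantVectorField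
    (hJ : IsLeftInvariantComplexStructure J) (v : Lie n G) (g : G) :
    J g (mulInvariantVectorField v g) = mulInvariantVectorField (J 1 v : Lie n G) g := by
  have h := (hJ.invariant g 1 v).symm
  have h2 : ∀ x, x = g → ∀ w : EuclideanSpace ℝ (Fin n),
      (show EuclideanSpace ℝ (Fin n) from J x w) = J g w := by
    rintro x rfl w
    rfl
  exact (h2 (g * 1) (mul_one g) _).symm.trans h

variable {Θ : G →* MulAut G}

omit [LieGroup (𝓡 n) ∞ G] in
lemma IsTwisting.contMDiff_apply (h : IsTwisting J Θ) (a : G) :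
    ContMDiff (𝓡 n) (𝓡 n) ∞ (Θ a) :=
  h.contMDiff.comp (contMDiff_const.prodMk contMDiff_id)

/-- Automorphisms carry left invariant fields to left invariant fields, and J acts on those through
its value at 1. So the commutation at 1 propagates to every point. -/
lemma IsTwisting.mfderiv_J (h : IsTwisting J Θ) (hJ : IsLeftInvariantComplexStructure J)
    (a g : G) (w : TangentSpace (𝓡 n) g) :
    mfderiv (𝓡 n) (𝓡 n) (Θ a) g (J g w) = J (Θ a g) (mfderiv (𝓡 n) (𝓡 n) (Θ a) g w) := by
  obtain ⟨v, rfl⟩ := exists_mulInvariantVectorField_eq g w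
  have hd : MDifferentiable (𝓡 n) (𝓡 n) (Θ a).toMonoidHom :=
    (h.contMDiff_apply a).mdifferentiable (by simp)
  have h1 := mfderiv_mulInvariantVectorField hd v g
  have h2 := mfderiv_mulInvariantVectorField hd (J 1 v) g
  rw [hJ.apply_mulInvariantVectorField]
  refine h2.trans (Eq.trans ?_ (congrArg (J (Θ a g)) h1).symm)
  refine Eq.trans ?_ (hJ.apply_mulInvariantVectorField _ _).symm
  rw [← h.map_J]

omit [LieGroup (𝓡 n) ∞ G] in
-- Invariance gives Θ(a • b) = Θ(a)Θ(b). Commutativity then brings both sides to a · Θ_a⁻¹(b) ·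
-- Θ_a⁻¹Θ_b⁻¹(c).
lemma IsTwisting.mul_assoc (h : IsTwisting J Θ) (a b c : G) :
    (a * (Θ a)⁻¹ b : G) * (Θ (a * (Θ a)⁻¹ b))⁻¹ c = a * (Θ a)⁻¹ (b * (Θ b)⁻¹ c) := by
  rw [← map_inv Θ a, map_mul Θ, h.map_apply, map_mul (Θ a⁻¹), mul_inv_rev, _root_.mul_assoc,
    map_inv Θ a, (h.commute b a).inv_inv.eq]
  rfl

omit [LieGroup (𝓡 n) ∞ G] in
lemma IsTwisting.inv_mul_cancel (h : IsTwisting J Θ) (a : G) :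
    Θ a a⁻¹ * (Θ (Θ a a⁻¹))⁻¹ a = 1 := by
  rw [h.map_apply, map_inv Θ, inv_inv, ← map_mul, _root_.inv_mul_cancel, map_one]

/-- The group structure `a • b = a · (Θ a)⁻¹ b`. -/
@[reducible] def IsTwisting.group (h : IsTwisting J Θ) : Group (Modification G) :=
  letI : Mul (Modification G) := ⟨fun a b => show G from (show G from a) * (Θ a)⁻¹ b⟩
  letI : One (Modification G) := ⟨(1 : G)⟩
  letI : Inv (Modification G) := ⟨fun a => Θ a (show G from a)⁻¹⟩
  Group.ofLeftAxioms h.mul_assoc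
    (fun a => by
      have : ∀ a : G, (1 : G) * (Θ 1)⁻¹ a = a := by simp
      exact this a)
    h.inv_mul_cancel

lemma IsTwisting.lieGroup (h : IsTwisting J Θ) :
    @LieGroup ℝ _ (EuclideanSpace ℝ (Fin n)) _ (EuclideanSpace ℝ (Fin n)) _ _ (𝓡 n) ∞
      (Modification G) h.group _ _ := by
  have hM : IsManifold (𝓡 n) ∞ (Modification G) := inferInstanceAs (IsManifold (𝓡 n) ∞ G)
  have hi : ContMDiff ((𝓡 n).prod (𝓡 n)) (𝓡 n) ∞ (fun q : G × G => (Θ q.1)⁻¹ q.2) := by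
    have : (fun q : G × G => (Θ q.1)⁻¹ q.2) = fun q : G × G => Θ q.1⁻¹ q.2 := by
      funext q
      rw [map_inv]
    rw [this]
    exact h.contMDiff.comp (contMDiff_fst.inv.prodMk contMDiff_snd)
  have h1 : ContMDiff ((𝓡 n).prod (𝓡 n)) (𝓡 n) ∞ (fun q : G × G => q.1 * (Θ q.1)⁻¹ q.2) :=
    contMDiff_fst.mul hi
  have h2 : ContMDiff (𝓡 n) (𝓡 n) ∞ (fun a : G => Θ a a⁻¹) :=
    h.contMDiff.comp (contMDiff_id.prodMk (contMDiff_inv (𝓡 n) ∞))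
  let _ := h.group
  exact { contMDiff_mul := h1, contMDiff_inv := h2 }

/-- The new left translation by a is L_a ∘ Θ(a⁻¹), and both factors preserve J. The other conditions
on J involve only the manifold. -/
lemma IsTwisting.isLeftInvariant (h : IsTwisting J Θ) (hJ : IsLeftInvariantComplexStructure J) :
    letI := h.group
    letI := h.lieGroup
    IsLeftInvariantComplexStructure J.onModification := by
  let _ := h.group
  have := h.lieGroup
  refine { toIsComplexStructure := ⟨hJ.smooth, hJ.sq, hJ.integrable⟩, invariant := ?_ }
  have key : ∀ (a b : G) (v : TangentSpace (𝓡 n) b),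
      mfderiv (𝓡 n) (𝓡 n) (fun x => a * (Θ a)⁻¹ x) b (J b v)
        = J (a * (Θ a)⁻¹ b) (mfderiv (𝓡 n) (𝓡 n) (fun x => a * (Θ a)⁻¹ x) b v) := by
    intro a b v
    have hd : MDifferentiable (𝓡 n) (𝓡 n) (Θ a⁻¹) :=
      (h.contMDiff_apply a⁻¹).mdifferentiable (by simp)
    have hc : mfderiv (𝓡 n) (𝓡 n) ((fun x => a * x) ∘ Θ a⁻¹) b =
      (mfderiv (𝓡 n) (𝓡 n) (fun x => a * x) (Θ a⁻¹ b)).comp (mfderiv (𝓡 n) (𝓡 n) (Θ a⁻¹) b) :=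
      mfderiv_comp b (mdifferentiable_mul_left (n := n) a (Θ a⁻¹ b)) (hd b)
    have h3 := h.mfderiv_J hJ a⁻¹ b v
    have h4 := hJ.invariant a (Θ a⁻¹ b) (mfderiv (𝓡 n) (𝓡 n) (Θ a⁻¹) b v)
    rw [← h3] at h4
    rw [← map_inv]
    change mfderiv (𝓡 n) (𝓡 n) ((fun x => a * x) ∘ Θ a⁻¹) b (J b v) =
      J (a * Θ a⁻¹ b) (mfderiv (𝓡 n) (𝓡 n) ((fun x => a * x) ∘ Θ a⁻¹) b v)
    rw [hc]
    exact h4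
  exact key

end Twist

/-! ### Quotient manifolds -/

section Quotient

open Filter Topology

variable {n : ℕ} {M : Type*} [TopologicalSpace M] [ChartedSpace (EuclideanSpace ℝ (Fin n)) M]
  {Q : Type*} [TopologicalSpace Q] {f : M → Q}

/-- Near x, φ z stays in the target of the local section, where the section inverts f; and f(φ z) =
f z. Thus section ∘ f is locally a deck transformation. -/
lemma localInverseAt_comp_eventuallyEq (hf : IsLocalHomeomorph f) {x₁ x : M} {φ : M → M}
    (hφ : Continuous φ) (hx : f x ∈ (hf.localInverseAt x₁).source)
    (hφx : φ x = hf.localInverseAt x₁ (f x)) (hfφ : ∀ z, f (φ z) = f z) :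
    (fun z => hf.localInverseAt x₁ (f z)) =ᶠ[𝓝 x] φ := by
  have h1 : (hf.localInverseAt x₁).target ∈ 𝓝 (φ x) :=
    (hf.localInverseAt x₁).open_target.mem_nhds (hφx ▸ (hf.localInverseAt x₁).map_source hx)
  filter_upwards [hφ.continuousAt.preimage_mem_nhds h1] with z hz
  have h2 := (hf.localInverseAt x₁).right_inv hz
  rwa [hf.localInverseAt_symm, hfφ] at h2

/-- The deck transformations of `f` act transitively on the fibres, by diffeomorphisms. -/
def HasDeckDiffeos (n : ℕ) {M : Type*} [TopologicalSpace M]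
    [ChartedSpace (EuclideanSpace ℝ (Fin n)) M] {Q : Type*} (f : M → Q) : Prop :=
  ∀ x y, f x = f y → ∃ φ : M ≃ₘ⟮𝓡 n, 𝓡 n⟯ M, φ x = y ∧ ∀ z, f (φ z) = f z

lemma contMDiffAt_localInverseAt_comp (hf : IsLocalHomeomorph f) (hd : HasDeckDiffeos n f)
    {x₁ x : M} (hx : f x ∈ (hf.localInverseAt x₁).source) :
    ContMDiffAt (𝓡 n) (𝓡 n) ∞ (fun z => hf.localInverseAt x₁ (f z)) x := by
  obtain ⟨φ, hφx, hφ⟩ := hd x (hf.localInverseAt x₁ (f x)) (hf.apply_localInverseAt_of_mem hx).symm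
  exact φ.contMDiff.contMDiffAt.congr_of_eventuallyEq
    (localInverseAt_comp_eventuallyEq hf φ.continuous hx hφx hφ)

variable [IsManifold (𝓡 n) ∞ M]

/-- A change of charts is a chart of M, after section ∘ f, after an inverse chart of M; the middle
map is locally a deck diffeomorphism. -/
lemma isManifold_of_hasDeckDiffeos (hf : IsLocalHomeomorph f) (hd : HasDeckDiffeos n f)
    {g : Q → M} (hg : Function.RightInverse g f) :
    letI : ChartedSpace (EuclideanSpace ℝ (Fin n)) Q := hf.chartedSpaceOfRightInverse hg
    IsManifold (𝓡 n) ∞ Q := by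
  let _ : ChartedSpace (EuclideanSpace ℝ (Fin n)) Q := hf.chartedSpaceOfRightInverse hg
  refine isManifold_of_contDiffOn (𝓡 n) ∞ Q ?_
  rintro _ _ ⟨q, rfl⟩ ⟨q', rfl⟩
  rw [← contMDiffOn_iff_contDiffOn]
  rintro u ⟨hu, -⟩
  simp only [OpenPartialHomeomorph.trans_source, OpenPartialHomeomorph.symm_source,
    Set.mem_preimage, Set.mem_inter_iff,
    OpenPartialHomeomorph.trans_symm_eq_symm_trans_symm, OpenPartialHomeomorph.coe_trans,
    Function.comp_apply, hf.localInverseAt_symm] at hu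
  obtain ⟨⟨hu1, hu2⟩, hu3, hu4⟩ := hu
  have h1 : ContMDiffAt (𝓡 n) (𝓡 n) ∞ (chartAt (EuclideanSpace ℝ (Fin n)) (g q)).symm u :=
    contMDiffOn_chart_symm.contMDiffAt ((chartAt _ (g q)).open_target.mem_nhds hu1)
  have h2 := contMDiffAt_localInverseAt_comp hf hd hu3
  have h3 : ContMDiffAt (𝓡 n) (𝓡 n) ∞ (chartAt (EuclideanSpace ℝ (Fin n)) (g q'))
      (hf.localInverseAt (g q') (f ((chartAt (EuclideanSpace ℝ (Fin n)) (g q)).symm u))) :=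
    contMDiffOn_chart.contMDiffAt ((chartAt _ (g q')).open_source.mem_nhds hu4)
  have h4 := h3.comp u (h2.comp u h1)
  refine ContMDiffAt.contMDiffWithinAt ?_
  convert! h4 using 1
  funext w
  simp [OpenPartialHomeomorph.trans_symm_eq_symm_trans_symm]

lemma isLocalDiffeomorph_of_hasDeckDiffeos (hf : IsLocalHomeomorph f) (hd : HasDeckDiffeos n f)
    {g : Q → M} (hg : Function.RightInverse g f) :
    letI : ChartedSpace (EuclideanSpace ℝ (Fin n)) Q := hf.chartedSpaceOfRightInverse hg
    IsLocalDiffeomorph (𝓡 n) (𝓡 n) ∞ f := by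
  let _ : ChartedSpace (EuclideanSpace ℝ (Fin n)) Q := hf.chartedSpaceOfRightInverse hg
  have : IsManifold (𝓡 n) ∞ Q := isManifold_of_hasDeckDiffeos hf hd hg
  let s : Q → OpenPartialHomeomorph Q M := fun q => hf.localInverseAt (g q)
  let c : Q → OpenPartialHomeomorph M (EuclideanSpace ℝ (Fin n)) := fun q => chartAt _ (g q)
  have hc : ∀ q, chartAt (EuclideanSpace ℝ (Fin n)) q = (s q).trans (c q) := fun q => rfl
  have hqs : ∀ q, g q ∈ (s q).target := fun q => hf.self_mem_localInverseAt_target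
  have hss : ∀ q, ((s q).symm : M → Q) = f := fun q => hf.localInverseAt_symm _
  have hsq : ∀ q, s q q = g q := fun q => by
    have := hf.localInverseAt_apply_self (x := g q)
    rwa [hg q] at this
  -- The chart of Q at f x is built at the chosen point g (f x). A deck transformation moves x
  -- there, and in these charts f becomes the identity.
  have hsmooth : ContMDiff (𝓡 n) (𝓡 n) ∞ f := by
    intro x
    obtain ⟨φ, hφx, hφ⟩ := hd x (g (f x)) (hg (f x)).symm
    have h0 : c (f x) (g (f x)) ∈ (chartAt (EuclideanSpace ℝ (Fin n)) (f x)).target := by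
      have := mem_chart_target (EuclideanSpace ℝ (Fin n)) (f x)
      rw [hc] at this ⊢
      simpa [hsq] using this
    have h1 : ContMDiffAt (𝓡 n) (𝓡 n) ∞ (chartAt (EuclideanSpace ℝ (Fin n)) (f x)).symm
        (c (f x) (g (f x))) :=
      contMDiffOn_chart_symm.contMDiffAt ((chartAt _ (f x)).open_target.mem_nhds h0)
    have h2 : ContMDiffAt (𝓡 n) (𝓡 n) ∞ (c (f x)) (φ x) :=
      contMDiffOn_chart.contMDiffAt ((chartAt _ (g (f x))).open_source.mem_nhds
        (by rw [hφx]; exact mem_chart_source _ _))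
    rw [← hφx] at h1
    refine (h1.comp x (h2.comp x φ.contMDiff.contMDiffAt)).congr_of_eventuallyEq ?_
    have h3 : (c (f x)).source ∈ 𝓝 (φ x) :=
      (c (f x)).open_source.mem_nhds (by rw [hφx]; exact mem_chart_source _ _)
    filter_upwards [φ.continuous.continuousAt.preimage_mem_nhds h3] with z hz
    have h4 := congrFun (hss (f x)) (φ z)
    simp only [hc, OpenPartialHomeomorph.trans_symm_eq_symm_trans_symm,
      OpenPartialHomeomorph.coe_trans, Function.comp_apply]
    rw [(c (f x)).left_inv hz, h4, hφ]
  -- The section used in the chart at y is smooth at y by construction. Near y, any other section is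
  -- itself composed with f and with that one.
  have hinv : ∀ x, ContMDiffOn (𝓡 n) (𝓡 n) ∞ (hf.localInverseAt x)
      (hf.localInverseAt x).source := by
    intro x y hy
    have h1 : ContMDiffAt (𝓡 n) (𝓡 n) ∞ (s y) y := by
      have h2 : ContMDiffAt (𝓡 n) (𝓡 n) ∞ (chartAt (EuclideanSpace ℝ (Fin n)) y) y :=
        contMDiffOn_chart.contMDiffAt (chart_source_mem_nhds _ _)
      have h3 : chartAt (EuclideanSpace ℝ (Fin n)) y y = c y (g y) := by
        rw [hc]
        simp [hsq]
      have h4 : ContMDiffAt (𝓡 n) (𝓡 n) ∞ (c y).symm (chartAt (EuclideanSpace ℝ (Fin n)) y y) := by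
        rw [h3]
        exact contMDiffOn_chart_symm.contMDiffAt (chart_target_mem_nhds _ _)
      refine (h4.comp y h2).congr_of_eventuallyEq ?_
      filter_upwards [chart_source_mem_nhds (EuclideanSpace ℝ (Fin n)) y] with z hz
      rw [hc] at hz
      simp only [OpenPartialHomeomorph.trans_source, Set.mem_inter_iff, Set.mem_preimage] at hz
      rw [hc]
      simp only [OpenPartialHomeomorph.coe_trans, Function.comp_apply]
      rw [(c y).left_inv hz.2]
    have h5 := contMDiffAt_localInverseAt_comp hf hd (x₁ := x) (x := g y) (by rwa [hg])
    rw [← hsq y] at h5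
    refine ContMDiffAt.contMDiffWithinAt ((h5.comp y h1).congr_of_eventuallyEq ?_)
    filter_upwards [(s y).open_source.mem_nhds (by
      have := hf.apply_self_mem_localInverseAt_source (x := g y)
      rwa [hg] at this)] with z hz
    exact congrArg _ (hf.apply_localInverseAt_of_mem hz).symm
  intro x
  refine ⟨{ toPartialEquiv := (hf.localInverseAt x).symm.toPartialEquiv
            open_source := (hf.localInverseAt x).open_target
            open_target := (hf.localInverseAt x).open_source
            contMDiffOn_toFun := ?_
            contMDiffOn_invFun := hinv x }, hf.self_mem_localInverseAt_target, ?_⟩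
  · have h1 : ((hf.localInverseAt x).symm : M → Q) = f := hf.localInverseAt_symm x
    change ContMDiffOn (𝓡 n) (𝓡 n) ∞ (hf.localInverseAt x).symm _
    rw [h1]
    exact hsmooth.contMDiffOn
  · intro z _
    exact (congrFun (hf.localInverseAt_symm x) z).symm

variable [ChartedSpace (EuclideanSpace ℝ (Fin n)) Q]

omit [IsManifold (𝓡 n) ∞ M] in
/-- Smoothness may be tested after composition with a surjective local diffeomorphism. -/
lemma contMDiff_of_comp_isLocalDiffeomorph (hf : IsLocalDiffeomorph (𝓡 n) (𝓡 n) ∞ f)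
    (hs : Function.Surjective f) {P : Type*} [TopologicalSpace P]
    [ChartedSpace (EuclideanSpace ℝ (Fin n)) P] {F : Q → P}
    (hF : ContMDiff (𝓡 n) (𝓡 n) ∞ (F ∘ f)) : ContMDiff (𝓡 n) (𝓡 n) ∞ F := by
  intro y
  obtain ⟨x, rfl⟩ := hs y
  have h1 := (hf x).localInverse_contMDiffAt
  refine (hF.contMDiffAt.comp (f x) h1).congr_of_eventuallyEq ?_
  filter_upwards [(hf x).localInverse_eventuallyEq_right] with z hz
  exact congrArg F hz.symm

end Quotient

/-! ### Descent of complex structures along a local diffeomorphism -/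

section Induced

open Filter Topology VectorField

variable {n : ℕ} {M Q : Type*} [TopologicalSpace M] [ChartedSpace (EuclideanSpace ℝ (Fin n)) M]
  [TopologicalSpace Q] [ChartedSpace (EuclideanSpace ℝ (Fin n)) Q] {f : M → Q}

lemma isInvertible_mfderiv_of_isLocalDiffeomorph (hf : IsLocalDiffeomorph (𝓡 n) (𝓡 n) ∞ f)
    (x : M) : (mfderiv (𝓡 n) (𝓡 n) f x).IsInvertible :=
  ⟨(hf x).mfderivToContinuousLinearEquiv (by simp), rfl⟩

/-- A field of endomorphisms which is invariant under the deck transformations descends. -/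
lemma exists_endField_of_deck (hf : IsLocalDiffeomorph (𝓡 n) (𝓡 n) ∞ f)
    (hs : Function.Surjective f) {J : EndField n M}
    (hd : ∀ x y, f x = f y → ∃ φ : M → M, MDifferentiableAt (𝓡 n) (𝓡 n) φ x ∧ φ x = y ∧
      (∀ z, f (φ z) = f z) ∧ ∀ v : TangentSpace (𝓡 n) x,
        mfderiv (𝓡 n) (𝓡 n) φ x (J x v) = J (φ x) (mfderiv (𝓡 n) (𝓡 n) φ x v)) :
    ∃ J' : EndField n Q, ∀ (x : M) (v : TangentSpace (𝓡 n) x),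
      mfderiv (𝓡 n) (𝓡 n) f x (J x v) = J' (f x) (mfderiv (𝓡 n) (𝓡 n) f x v) := by
  obtain ⟨g, hg⟩ := hs.hasRightInverse
  let D : (x : M) → EuclideanSpace ℝ (Fin n) →L[ℝ] EuclideanSpace ℝ (Fin n) := fun x =>
    mfderiv (𝓡 n) (𝓡 n) f x
  let J₀ : (x : M) → EuclideanSpace ℝ (Fin n) →L[ℝ] EuclideanSpace ℝ (Fin n) := fun x => J x
  have hD : ∀ x, (D x).IsInvertible := isInvertible_mfderiv_of_isLocalDiffeomorph hf
  -- J is transported from one chosen point g q of each fibre; invariance under deck transformations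
  -- gives the relation at the other points.
  refine ⟨fun q => ((D (g q)).comp (J₀ (g q))).comp (D (g q)).inverse, fun x v => ?_⟩
  obtain ⟨φ, hφd, hφx, hφ, hφJ⟩ := hd x (g (f x)) (hg (f x)).symm
  let P : EuclideanSpace ℝ (Fin n) →L[ℝ] EuclideanSpace ℝ (Fin n) := mfderiv (𝓡 n) (𝓡 n) φ x
  have h1 : D x = (D (φ x)).comp P := by
    have h2 := mfderiv_comp x (hf.mdifferentiable (by simp) (φ x)) hφd
    rw [show f ∘ φ = f from funext hφ] at h2
    exact h2
  have h3 : ∀ v, P (J₀ x v) = J₀ (φ x) (P v) := hφJ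
  rw [hφx] at h1 h3
  have h4 : ∀ v, D x (J₀ x v) = D (g (f x)) (J₀ (g (f x)) ((D (g (f x))).inverse (D x v))) := by
    intro v
    have h5 : ∀ w, (D (g (f x))).inverse (D (g (f x)) w) = w := fun w =>
      congrArg (fun L : EuclideanSpace ℝ (Fin n) →L[ℝ] EuclideanSpace ℝ (Fin n) => L w)
        (hD _).inverse_comp_self
    rw [h1]
    simp only [ContinuousLinearMap.comp_apply]
    rw [h3, h5]
  exact h4 v

variable [IsManifold (𝓡 n) ∞ M] [IsManifold (𝓡 n) ∞ Q]

/-- Over the source of a local inverse s of f, J' = Tf ∘ J ∘ Ts on tangent bundles. -/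
lemma contMDiff_of_induced (hf : IsLocalDiffeomorph (𝓡 n) (𝓡 n) ∞ f)
    (hs : Function.Surjective f) {J : EndField n M} {J' : EndField n Q}
    (hJ : ContMDiff (𝓡 n).tangent (𝓡 n).tangent ∞
      (fun v : TangentBundle (𝓡 n) M => (⟨v.proj, J v.proj v.snd⟩ : TangentBundle (𝓡 n) M)))
    (hJ' : ∀ (x : M) (v : TangentSpace (𝓡 n) x),
      mfderiv (𝓡 n) (𝓡 n) f x (J x v) = J' (f x) (mfderiv (𝓡 n) (𝓡 n) f x v)) :
    ContMDiff (𝓡 n).tangent (𝓡 n).tangent ∞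
      (fun v : TangentBundle (𝓡 n) Q => (⟨v.proj, J' v.proj v.snd⟩ : TangentBundle (𝓡 n) Q)) := by
  rintro ⟨y, v⟩
  obtain ⟨x, rfl⟩ := hs y
  set s := (hf x).localInverse with hsdef
  have hU : IsOpen s.source := s.open_source
  have hx : f x ∈ s.source := (hf x).localInverse_mem_source
  have hss : ContMDiffOn (𝓡 n) (𝓡 n) ∞ s s.source := (hf x).localInverse_contMDiffOn
  have h1 := hss.contMDiffOn_tangentMapWithin (m := ∞) (by simp) hU.uniqueMDiffOn
  have hopen : IsOpen (Bundle.TotalSpace.proj (F := EuclideanSpace ℝ (Fin n))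
      (E := (TangentSpace (𝓡 n) : Q → Type _)) ⁻¹' s.source) :=
    hU.preimage (FiberBundle.continuous_proj _ _)
  have h2 : ContMDiffAt (𝓡 n).tangent (𝓡 n).tangent ∞ (tangentMapWithin (𝓡 n) (𝓡 n) s s.source)
      (⟨f x, v⟩ : TangentBundle (𝓡 n) Q) := h1.contMDiffAt (hopen.mem_nhds hx)
  have h3 : ContMDiff (𝓡 n).tangent (𝓡 n).tangent ∞ (tangentMap (𝓡 n) (𝓡 n) f) :=
    hf.contMDiff.contMDiff_tangentMap (by simp)
  refine ((h3.comp hJ).contMDiffAt.comp _ h2).congr_of_eventuallyEq ?_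
  filter_upwards [hopen.mem_nhds (show (⟨f x, v⟩ : TangentBundle (𝓡 n) Q) ∈ _ from hx)]
  rintro ⟨q, w⟩ (hq : q ∈ s.source)
  have h4 : mfderivWithin (𝓡 n) (𝓡 n) s s.source q = mfderiv (𝓡 n) (𝓡 n) s q :=
    mfderivWithin_of_isOpen hU hq
  have hsd : MDifferentiableAt (𝓡 n) (𝓡 n) s q :=
    (hss.contMDiffAt (hU.mem_nhds hq)).mdifferentiableAt (by simp)
  have h5 : (mfderiv (𝓡 n) (𝓡 n) f (s q)).comp (mfderiv (𝓡 n) (𝓡 n) s q) =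
      ContinuousLinearMap.id ℝ _ := by
    rw [← mfderiv_comp q (hf.mdifferentiable (by simp) (s q)) hsd]
    have : f ∘ s =ᶠ[𝓝 q] id := by
      filter_upwards [hU.mem_nhds hq] with z hz
      exact (hf x).localInverse_right_inv hz
    rw [this.mfderiv_eq]
    exact mfderiv_id
  have h6 : f (s q) = q := (hf x).localInverse_right_inv hq
  simp only [Function.comp_apply, tangentMap, tangentMapWithin]
  rw [h4, hJ']
  have h7 : (mfderiv (𝓡 n) (𝓡 n) f (s q)) ((mfderiv (𝓡 n) (𝓡 n) s q) w) = w :=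
    congrArg (fun L : EuclideanSpace ℝ (Fin n) →L[ℝ] EuclideanSpace ℝ (Fin n) => L w) h5
  have h8 : ∀ (r : Q), r = q → ∀ (u : TangentSpace (𝓡 n) r) (w : TangentSpace (𝓡 n) q),
      (show EuclideanSpace ℝ (Fin n) from u) = w → (⟨q, J' q w⟩ : TangentBundle (𝓡 n) Q) =
      ⟨r, J' r u⟩ := by
    rintro r rfl u w rfl
    rfl
  exact h8 _ h6 _ _ h7

/-- Pullback by f exchanges J' with J and commutes with brackets. So the vanishing of the Nijenhuis
tensor of J on pulled back fields, pushed forward by the differential of f, gives that of J'. -/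
lemma isComplexStructure_of_induced (hf : IsLocalDiffeomorph (𝓡 n) (𝓡 n) ∞ f)
    (hs : Function.Surjective f) {J : EndField n M} {J' : EndField n Q}
    (hJ : IsComplexStructure J)
    (hJ' : ∀ (x : M) (v : TangentSpace (𝓡 n) x),
      mfderiv (𝓡 n) (𝓡 n) f x (J x v) = J' (f x) (mfderiv (𝓡 n) (𝓡 n) f x v)) :
    IsComplexStructure J' := by
  have hsm := contMDiff_of_induced hf hs hJ.smooth hJ'
  have hinv := isInvertible_mfderiv_of_isLocalDiffeomorph hf
  refine ⟨hsm, fun y v => ?_, fun y X Y hX hY => ?_⟩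
  · obtain ⟨x, rfl⟩ := hs y
    obtain ⟨e, he⟩ := hinv x
    obtain ⟨w, rfl⟩ := e.surjective v
    have h1 : e w = mfderiv (𝓡 n) (𝓡 n) f x w := by rw [← he]; rfl
    rw [h1, ← hJ', ← hJ', hJ.sq, map_neg]
  · obtain ⟨x, rfl⟩ := hs y
    have hpull : ∀ Z : (q : Q) → TangentSpace (𝓡 n) q,
        mpullback (𝓡 n) (𝓡 n) f (fun q => J' q (Z q)) =
          fun z => J z (mpullback (𝓡 n) (𝓡 n) f Z z) := by
      intro Z
      funext z
      obtain ⟨e, he⟩ := hinv z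
      have h1 : ∀ w, mfderiv (𝓡 n) (𝓡 n) f z w = e w := fun w => by rw [← he]; rfl
      rw [mpullback_apply, mpullback_apply, ← he, ContinuousLinearMap.inverse_equiv]
      obtain ⟨w, hw⟩ := e.surjective (Z (f z))
      rw [← hw]
      change e.symm (J' (f z) (e w)) = J z (e.symm (e w))
      rw [← h1 w, ← hJ', h1, e.symm_apply_apply, h1, e.symm_apply_apply]
    have hJX : ∀ Z : (q : Q) → TangentSpace (𝓡 n) q, SmoothFieldAt Z (f x) →
        SmoothFieldAt (fun q => J' q (Z q)) (f x) := fun Z hZ =>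
      hsm.contMDiffAt.comp (f x) hZ
    have hsp : ∀ Z : (q : Q) → TangentSpace (𝓡 n) q, SmoothFieldAt Z (f x) →
        SmoothFieldAt (mpullback (𝓡 n) (𝓡 n) f Z) x := fun Z hZ =>
      ContMDiffAt.mpullback_vectorField_preimage hZ (hf.contMDiff x) (hinv x) (by simp)
    have hbr : ∀ Z W : (q : Q) → TangentSpace (𝓡 n) q, SmoothFieldAt Z (f x) →
        SmoothFieldAt W (f x) → mpullback (𝓡 n) (𝓡 n) f (mlieBracket (𝓡 n) Z W) x =
          mlieBracket (𝓡 n) (mpullback (𝓡 n) (𝓡 n) f Z) (mpullback (𝓡 n) (𝓡 n) f W) x :=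
      fun Z W hZ hW => by
        have : IsManifold (𝓡 n) (minSmoothness ℝ 3) M := by
          rw [minSmoothness_of_isRCLikeNormedField]
          exact IsManifold.of_le (n := ∞) (WithTop.coe_le_coe.2 le_top)
        have : IsManifold (𝓡 n) (minSmoothness ℝ 3) Q := by
          rw [minSmoothness_of_isRCLikeNormedField]
          exact IsManifold.of_le (n := ∞) (WithTop.coe_le_coe.2 le_top)
        exact mpullback_mlieBracket (n := ∞) (ContMDiffAt.mdifferentiableAt hZ (by simp))
          (ContMDiffAt.mdifferentiableAt hW (by simp)) (hf.contMDiff x)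
          (by rw [minSmoothness_of_isRCLikeNormedField]; exact WithTop.coe_le_coe.2 le_top)
    have key := hJ.integrable x _ _ (hsp X hX) (hsp Y hY)
    rw [← hpull X, ← hpull Y, ← hbr _ _ (hJX X hX) (hJX Y hY), ← hbr _ _ (hJX X hX) hY,
      ← hbr _ _ hX (hJX Y hY), ← hbr _ _ hX hY] at key
    have hp : ∀ Z : (q : Q) → TangentSpace (𝓡 n) q,
        mfderiv (𝓡 n) (𝓡 n) f x (mpullback (𝓡 n) (𝓡 n) f Z x) = Z (f x) := fun Z => by
      obtain ⟨e, he⟩ := hinv x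
      rw [mpullback_apply, ← he, ContinuousLinearMap.inverse_equiv]
      exact e.apply_symm_apply _
    have key2 := congrArg (mfderiv (𝓡 n) (𝓡 n) f x) key
    rw [map_sub, map_sub, map_sub, hJ', hJ', hp, hp, hp, hp, map_zero] at key2
    exact key2

end Induced

/-! ### Quotients of a Lie group by lattices -/

section LeftQuotients

variable {n : ℕ} {G : Type*} [TopologicalSpace G] [ChartedSpace (EuclideanSpace ℝ (Fin n)) G]
  [Group G]

omit [TopologicalSpace G] [ChartedSpace (EuclideanSpace ℝ (Fin n)) G] in
lemma LeftQuotient.mk_eq_mk_iff {Γ : Subgroup G} {a b : G} :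
    LeftQuotient.mk Γ a = LeftQuotient.mk Γ b ↔ ∃ γ ∈ Γ, γ * b = a := by
  refine (Quotient.eq (r := MulAction.orbitRel Γ G)).trans ?_
  rw [MulAction.orbitRel_apply, MulAction.mem_orbit_iff]
  simp [Subgroup.smul_def]

omit [TopologicalSpace G] [ChartedSpace (EuclideanSpace ℝ (Fin n)) G] in
lemma LeftQuotient.mk_surjective (Γ : Subgroup G) : Function.Surjective (LeftQuotient.mk Γ) :=
  Quotient.mk_surjective

variable [LieGroup (𝓡 n) ∞ G] [T2Space G]

variable (n) in
-- Exposes the local sections behind the charted space instance, so that the results on deck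
-- transformations apply to it.
lemma LeftQuotient.exists_chartedSpace_eq (Γ : Subgroup G) [IsLattice Γ] :
    ∃ (hf : IsLocalHomeomorph (LeftQuotient.mk Γ)) (g : LeftQuotient Γ → G)
      (hg : Function.RightInverse g (LeftQuotient.mk Γ)),
      (inferInstance : ChartedSpace (EuclideanSpace ℝ (Fin n)) (LeftQuotient Γ)) =
        hf.chartedSpaceOfRightInverse hg :=
  ⟨_, _, (LeftQuotient.mk_surjective Γ).hasRightInverse.choose_spec, rfl⟩

omit [T2Space G] in
lemma LeftQuotient.hasDeckDiffeos (Γ : Subgroup G) : HasDeckDiffeos n (LeftQuotient.mk Γ) := by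
  intro x y hxy
  obtain ⟨γ, hγ, rfl⟩ := LeftQuotient.mk_eq_mk_iff.1 hxy.symm
  refine ⟨{ toEquiv := Equiv.mulLeft γ
            contMDiff_toFun := contMDiff_mul_left (a := γ)
            contMDiff_invFun := contMDiff_mul_left (a := γ⁻¹) }, rfl, fun z => ?_⟩
  exact LeftQuotient.mk_eq_mk_iff.2 ⟨γ, hγ, rfl⟩

variable (n) in
lemma LeftQuotient.isManifold (Γ : Subgroup G) [IsLattice Γ] :
    IsManifold (𝓡 n) ∞ (LeftQuotient Γ) := by
  obtain ⟨hf, g, hg, h⟩ := LeftQuotient.exists_chartedSpace_eq n Γ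
  have := isManifold_of_hasDeckDiffeos hf (LeftQuotient.hasDeckDiffeos (n := n) Γ) hg
  rwa [← h] at this

variable (n) in
lemma LeftQuotient.isLocalDiffeomorph (Γ : Subgroup G) [IsLattice Γ] :
    IsLocalDiffeomorph (𝓡 n) (𝓡 n) ∞ (LeftQuotient.mk Γ) := by
  obtain ⟨hf, g, hg, h⟩ := LeftQuotient.exists_chartedSpace_eq n Γ
  have := isLocalDiffeomorph_of_hasDeckDiffeos hf (LeftQuotient.hasDeckDiffeos (n := n) Γ) hg
  rwa [← h] at this

/-- Points of one fibre differ by a left translation by Γ, which preserves J; hence J descends. -/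
lemma exists_isInducedComplexStructure (Γ : Subgroup G) [IsLattice Γ] {J : EndField n G}
    (hJ : IsLeftInvariantComplexStructure J) :
    ∃ J' : EndField n (LeftQuotient Γ), IsInducedComplexStructure Γ J J' := by
  have hM := LeftQuotient.isManifold n Γ
  have hf := LeftQuotient.isLocalDiffeomorph n Γ
  have hs := LeftQuotient.mk_surjective Γ
  obtain ⟨J', hJ'⟩ := exists_endField_of_deck hf hs (J := J) (by
    intro x y hxy
    obtain ⟨γ, hγ, rfl⟩ := LeftQuotient.mk_eq_mk_iff.1 hxy.symm
    exact ⟨fun z => γ * z, mdifferentiable_mul_left (n := n) γ x, rfl,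
      fun z => LeftQuotient.mk_eq_mk_iff.2 ⟨γ, hγ, rfl⟩, hJ.invariant γ x⟩)
  exact ⟨J', hM, hf, isComplexStructure_of_induced hf hs hJ.toIsComplexStructure hJ', hJ'⟩

/-- A bijection between quotients of the same complex manifold, compatible with the projections, is
biholomorphic. -/
lemma biholomorphic_of_comp {M Q Q' : Type*} [TopologicalSpace M]
    [ChartedSpace (EuclideanSpace ℝ (Fin n)) M] [TopologicalSpace Q]
    [ChartedSpace (EuclideanSpace ℝ (Fin n)) Q] [TopologicalSpace Q']
    [ChartedSpace (EuclideanSpace ℝ (Fin n)) Q'] {f : M → Q} {f' : M → Q'}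
    (hf : IsLocalDiffeomorph (𝓡 n) (𝓡 n) ∞ f) (hf' : IsLocalDiffeomorph (𝓡 n) (𝓡 n) ∞ f')
    (hs : Function.Surjective f) (hs' : Function.Surjective f') (F : Q ≃ Q') (hF : F ∘ f = f')
    {J : EndField n M} {J₁ : EndField n Q} {J₂ : EndField n Q'}
    (h₁ : ∀ (x : M) (v : TangentSpace (𝓡 n) x),
      mfderiv (𝓡 n) (𝓡 n) f x (J x v) = J₁ (f x) (mfderiv (𝓡 n) (𝓡 n) f x v))
    (h₂ : ∀ (x : M) (v : TangentSpace (𝓡 n) x),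
      mfderiv (𝓡 n) (𝓡 n) f' x (J x v) = J₂ (f' x) (mfderiv (𝓡 n) (𝓡 n) f' x v)) :
    Biholomorphic J₁ J₂ := by
  subst hF
  have hF1 : ContMDiff (𝓡 n) (𝓡 n) ∞ F :=
    contMDiff_of_comp_isLocalDiffeomorph hf hs hf'.contMDiff
  have hF2 : ContMDiff (𝓡 n) (𝓡 n) ∞ F.symm := by
    refine contMDiff_of_comp_isLocalDiffeomorph hf' hs' ?_
    rw [← Function.comp_assoc, F.symm_comp_self]
    exact hf.contMDiff
  refine ⟨⟨F, hF1, hF2⟩, fun y w => ?_⟩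
  -- The differential of f is onto, so the relation need only be tested on images of vectors of M,
  -- where it is the chain rule for F ∘ f.
  obtain ⟨x, rfl⟩ := hs y
  obtain ⟨e, he⟩ := isInvertible_mfderiv_of_isLocalDiffeomorph hf x
  obtain ⟨v, rfl⟩ := e.surjective w
  have h3 : e v = mfderiv (𝓡 n) (𝓡 n) f x v := by rw [← he]; rfl
  have h4 : ∀ v, mfderiv (𝓡 n) (𝓡 n) (F ∘ f) x v =
      mfderiv (𝓡 n) (𝓡 n) F (f x) (mfderiv (𝓡 n) (𝓡 n) f x v) := fun v => by
    rw [mfderiv_comp x (hF1.mdifferentiable (by simp) (f x)) (hf.mdifferentiable (by simp) x)]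
    rfl
  have h5 := h₂ x v
  rw [h4, h4, h₁, ← h3] at h5
  exact h5

end LeftQuotients

/-! ### The lattice inside the modification -/

section ModificationLattice

variable {n : ℕ} {G : Type*} [TopologicalSpace G] [ChartedSpace (EuclideanSpace ℝ (Fin n)) G]
  [Group G] [LieGroup (𝓡 n) ∞ G] {J : EndField n G} {Θ : G →* MulAut G}

/-- A subgroup on which the action is trivial, as a subgroup of the modification. -/
def IsTwisting.subgroup (h : IsTwisting J Θ) {Γ : Subgroup G} (hΓ : ∀ γ ∈ Γ, Θ γ = 1) :
    letI := h.group
    Subgroup (Modification G) :=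
  letI := h.group
  { carrier := {a : Modification G | (show G from a) ∈ Γ}
    mul_mem' := fun {a b} ha hb => by
      change (show G from a) * (Θ a)⁻¹ b ∈ Γ
      rw [hΓ a ha]
      exact Γ.mul_mem ha hb
    one_mem' := Γ.one_mem
    inv_mem' := fun {a} ha => by
      change Θ a (show G from a)⁻¹ ∈ Γ
      rw [hΓ a ha]
      exact Γ.inv_mem ha }

omit [LieGroup (𝓡 n) ∞ G] in
-- For γ in Γ both products γ • b and γ b agree, so the orbits of Γ are the same.
lemma IsTwisting.mk_subgroup_eq_iff (h : IsTwisting J Θ) {Γ : Subgroup G}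
    (hΓ : ∀ γ ∈ Γ, Θ γ = 1) (a b : G) :
    letI := h.group
    LeftQuotient.mk (h.subgroup hΓ) (toModification a) =
      LeftQuotient.mk (h.subgroup hΓ) (toModification b) ↔
      LeftQuotient.mk Γ a = LeftQuotient.mk Γ b := by
  let _ := h.group
  rw [LeftQuotient.mk_eq_mk_iff, LeftQuotient.mk_eq_mk_iff]
  have hmul : ∀ γ ∈ Γ, γ * (Θ γ)⁻¹ b = γ * b := fun γ hγ => by
    rw [hΓ γ hγ]
    rfl
  exact ⟨fun ⟨γ, hγ, h1⟩ => ⟨γ, hγ, (hmul γ hγ).symm.trans h1⟩,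
    fun ⟨γ, hγ, h1⟩ => ⟨γ, hγ, (hmul γ hγ).trans h1⟩⟩

/-- The identity of `G`, as a bijection of the quotients of `G` and of the modification. -/
noncomputable def IsTwisting.quotientEquiv (h : IsTwisting J Θ) {Γ : Subgroup G}
    (hΓ : ∀ γ ∈ Γ, Θ γ = 1) :
    letI := h.group
    LeftQuotient Γ ≃ LeftQuotient (h.subgroup hΓ) :=
  letI := h.group
  Quotient.congr (Equiv.refl G) fun a b =>
    (Quotient.eq (r := MulAction.orbitRel Γ G)).symm.trans
      ((h.mk_subgroup_eq_iff hΓ a b).symm.trans Quotient.eq)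

omit [LieGroup (𝓡 n) ∞ G] in
-- Discreteness concerns only the topology, which has not changed, and the new quotient is a
-- continuous image of the compact Γ\G.
lemma IsTwisting.isLattice (h : IsTwisting J Θ) {Γ : Subgroup G} [hL : IsLattice Γ]
    (hΓ : ∀ γ ∈ Γ, Θ γ = 1) :
    letI := h.group
    IsLattice (h.subgroup hΓ) := by
  let _ := h.group
  refine ⟨hL.discrete, ?_⟩
  have hc : Continuous (h.quotientEquiv hΓ) :=
    continuous_quot_lift _ (continuous_quotient_mk' (s := MulAction.orbitRel (h.subgroup hΓ)
      (Modification G)))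
  have := hL.cocompact
  exact (h.quotientEquiv hΓ).surjective.compactSpace hc

end ModificationLattice
end SMod

/-! ### Assembly of the theorem -/

theorem mainTheorem12 {n : ℕ} {G : Type*} [TopologicalSpace G]
    [ChartedSpace (EuclideanSpace ℝ (Fin n)) G] [Group G] [LieGroup (𝓡 n) ∞ G] [T2Space G]
    [SimplyConnectedSpace G] [Group.IsSolvable G]
    (V : Submodule ℝ (SMod.Lie n G)) (hV : SMod.IsAdmissibleComplement V)
    (S : Subgroup (SMod.GLin (SMod.Lie n G))) (hS : SMod.IsAlgebraicTorus S)
    (hST : S ≤ SMod.maxTorus hV)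
    (p : SMod.identityComponent (SMod.maxTorus hV) →* SMod.identityComponent S)
    (hp : SMod.IsProjection (SMod.maxTorus hV) S p)
    (J : SMod.EndField n G) (hJ : SMod.IsLeftInvariantComplexStructure J)
    (hcomm : ∀ (g : G) (v : SMod.Lie n G),
      J 1 ((SMod.Ads hV g : Module.End ℝ (SMod.Lie n G)) v)
        = (SMod.Ads hV g : Module.End ℝ (SMod.Lie n G)) (J 1 v)) :
    ∃ (_ : Group (SMod.Modification G)) (_ : LieGroup (𝓡 n) ∞ (SMod.Modification G)),
      (∀ a b : G, SMod.toModification a * SMod.toModification b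
        = SMod.toModification (SMod.modMul hV p a b)) ∧
      SMod.IsLeftInvariantComplexStructure J.onModification ∧
      ∀ (Γ : Subgroup G) [SMod.IsLattice Γ], (∀ γ ∈ Γ, SMod.piS hV p γ = 1) →
        ∃ (Γ' : Subgroup (SMod.Modification G)) (_ : SMod.IsLattice Γ'),
          (∀ a : G, SMod.toModification a ∈ Γ' ↔ a ∈ Γ) ∧
          ∃ (JΓ : SMod.EndField n (SMod.LeftQuotient Γ))
            (JΓ' : SMod.EndField n (SMod.LeftQuotient Γ')),
            SMod.IsInducedComplexStructure Γ J JΓ ∧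
            SMod.IsInducedComplexStructure Γ' J.onModification JΓ' ∧
            SMod.Biholomorphic JΓ JΓ' := by
  have h := SMod.isTwisting_action hV hST (p := p) hcomm
  let _ := h.group
  have := h.lieGroup
  have hJ' := h.isLeftInvariant hJ
  refine ⟨h.group, h.lieGroup, fun a b => rfl, hJ', fun Γ _ hΓ => ?_⟩
  have hΓ' : ∀ γ ∈ Γ, SMod.action (SMod.piS hV p) γ = 1 := fun γ hγ =>
    SMod.action_eq_one hV (hΓ γ hγ)
  have hL := h.isLattice hΓ'
  obtain ⟨JΓ, h1⟩ := SMod.exists_isInducedComplexStructure Γ hJ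
  obtain ⟨JΓ', h2⟩ := SMod.exists_isInducedComplexStructure (h.subgroup hΓ') hJ'
  have hs := SMod.LeftQuotient.mk_surjective (h.subgroup hΓ')
  exact ⟨h.subgroup hΓ', hL, fun a => Iff.rfl, JΓ, JΓ', h1, h2,
    -- Both projections start from the same complex manifold G, and `quotientEquiv` is the identity
    -- on representatives, so compatibility with them is definitional.
    SMod.biholomorphic_of_comp h1.isLocalDiffeomorph h2.isLocalDiffeomorph
      (SMod.LeftQuotient.mk_surjective Γ) hs
      (h.quotientEquiv hΓ') rfl h1.induced h2.induced⟩
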